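/- For $f:\{0,1\}^n\to\{0,1\}$ and $x\in\{0,1\}^n$, a certificate for $f$'s value at $x$ is a set $S\subseteq[n]$ such that $f(y)=f(x)$ for all $y$ that agree with $x$ on $S$; $\mathrm{Cert}(f,x)$ is the size of a smallest one, and $\mathrm{Cert}(f)=\max_x \mathrm{Cert}(f,x)$. A restriction $\pi$ fixes some of the $n$ variables to constants, $|\pi|$ is the number of variables it fixes, and $f_\pi$ is the resulting function of the remaining variables. There are a language $L\in\mathsf{NP}$, a randomized algorithm $\mathcal A$ with oracle access to $L$, a polynomial $p$ and a constant $K$ such that the following holds for every $n\in\mathbb N$, every Boolean circuit computing a function $f:\{0,1\}^n\to\{0,1\}$, with $s$ gates, and every $\delta\in(0,1)$. Given the circuit and $\lceil\log_2(1/\delta)\rceil$, the algorithm $\mathcal A$ halts within $p(n,s,\log(1/\delta))$ steps for all outcomes of its coin tosses, and with probability at least $1-\delta$ it outputs a restriction $\pi$ with $|\pi|\le K\cdot \mathrm{Cert}(f)^4$ such that $f_\pi$ is a constant function. In particular, on circuits of size $\mathrm{poly}(n)$ the running time is $\mathrm{poly}(n,\log(1/\delta))$. -/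

import Mathlib

namespace Certification

/-! ### Certificates and restrictions of Boolean functions -/

/-- `S` is a certificate for the value of `f` at `x`. -/
def IsCertificate {n : ℕ} (f : (Fin n → Bool) → Bool) (x : Fin n → Bool)
    (S : Finset (Fin n)) : Prop :=
  ∀ y : Fin n → Bool, (∀ i ∈ S, y i = x i) → f y = f x

/-- The size of a smallest certificate for the value of `f` at `x`. (The set of sizes is never
empty, since the set of all coordinates is a certificate.) -/
noncomputable def certAt {n : ℕ} (f : (Fin n → Bool) → Bool) (x : Fin n → Bool) : ℕ :=
  sInf {k : ℕ | ∃ S : Finset (Fin n), IsCertificate f x S ∧ S.card = k}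

/-- The certificate complexity of `f`: the maximum of `certAt f x` over all inputs `x`. -/
noncomputable def cert {n : ℕ} (f : (Fin n → Bool) → Bool) : ℕ :=
  Finset.univ.sup (certAt f)

/-- A restriction: `some b` means that the variable is fixed to `b`, `none` that it is free. -/
abbrev Restriction (n : ℕ) : Type := Fin n → Option Bool

/-- The number of variables that a restriction fixes. -/
def Restriction.length {n : ℕ} (π : Restriction n) : ℕ :=
  (Finset.univ.filter fun i => (π i).isSome).card

/-- The restricted function `f_π`, as a function of all variables that ignores the fixed ones. -/
def restrict {n : ℕ} (f : (Fin n → Bool) → Bool) (π : Restriction n) : (Fin n → Bool) → Bool :=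
  fun x => f fun i => (π i).getD (x i)

/-- `g` is a constant function. -/
def IsConstant {n : ℕ} (g : (Fin n → Bool) → Bool) : Prop :=
  ∃ b : Bool, ∀ x, g x = b

/-! ### Boolean circuits -/

/-- The gates of a circuit; the natural numbers are the wires that enter the gate. -/
inductive Gate : Type
  | const (b : Bool)
  | not (u : ℕ)
  | and (u v : ℕ)
  | or (u v : ℕ)

namespace Gate

/-- All wires that enter the gate are among the wires `0, …, m - 1`. -/
def Below (m : ℕ) : Gate → Prop
  | const _ => True
  | not u => u < m
  | and u v => u < m ∧ v < m
  | or u v => u < m ∧ v < m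

/-- The value of the gate when the wires carry the values `w`. -/
def eval (w : ℕ → Bool) : Gate → Bool
  | const b => b
  | not u => !(w u)
  | and u v => w u && w v
  | or u v => w u || w v

/-- Numerical code of the kind of gate. -/
def kind : Gate → ℕ
  | const false => 0
  | const true => 1
  | not _ => 2
  | and _ _ => 3
  | or _ _ => 4

/-- The first entering wire (`0` if there is none). -/
def fst : Gate → ℕ
  | const _ => 0
  | not u => u
  | and u _ => u
  | or u _ => u

/-- The second entering wire (`0` if there is none). -/
def snd : Gate → ℕ
  | const _ => 0
  | not _ => 0
  | and _ v => v
  | or _ v => v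

end Gate

/-- Boolean circuits on `n` inputs. Wires `0, …, n - 1` are the inputs, wire `n + j` is the output
of gate number `j`, whose entering wires must all come earlier. -/
structure Circuit (n : ℕ) where
  gates : List Gate
  output : ℕ
  wf : ∀ (j : ℕ) (h : j < gates.length), (gates[j]'h).Below (n + j)
  output_lt : output < n + gates.length

namespace Circuit

/-- The number of gates. -/
def size {n : ℕ} (C : Circuit n) : ℕ := C.gates.length

/-- The values of all wires, in order, on input `x`. -/
def wires {n : ℕ} (C : Circuit n) (x : Fin n → Bool) : List Bool :=
  C.gates.foldl (fun v g => v ++ [g.eval fun u => v.getD u false]) (List.ofFn x)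

/-- The Boolean function that the circuit computes. -/
def eval {n : ℕ} (C : Circuit n) (x : Fin n → Bool) : Bool :=
  (C.wires x).getD C.output false

end Circuit

/-! ### Randomized oracle RAM programs with a step count -/

/-- The memory of a random access machine: `m a i` is cell number `i` of array number `a`. A
program mentions finitely many arrays only. -/
abbrev Memory : Type := ℕ → ℕ → ℕ

/-- Arithmetic expressions: constants, (indirect) memory access, addition, truncated subtraction,
comparison. There is no multiplication, so one step adds only a constant number of bits to the
largest stored number, and unit cost per step is polynomially equivalent to Turing machine time. -/
inductive Expr : Type
  | const (k : ℕ)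
  | read (a : ℕ) (i : Expr)
  | add (e e' : Expr)
  | sub (e e' : Expr)
  | lt (e e' : Expr)

/-- The value of an expression. -/
def Expr.eval (m : Memory) : Expr → ℕ
  | const k => k
  | read a i => m a (i.eval m)
  | add e e' => e.eval m + e'.eval m
  | sub e e' => e.eval m - e'.eval m
  | lt e e' => if e.eval m < e'.eval m then 1 else 0

/-- Programs.
* `assign a i e` stores the value of `e` in cell `i` of array `a`;
* `flip a i` tosses a fair coin and stores the result (`0` or `1`) in cell `i` of array `a`;
* `query a l b` asks the oracle about the bit string held by the first `l` cells of array `a`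
  (nonzero means `true`) and stores the answer (`0` or `1`) in cell `0` of array `b`;
* the rest is sequential composition, branching and looping; a condition is true if nonzero. -/
inductive Prog : Type
  | skip
  | assign (a : ℕ) (i e : Expr)
  | flip (a : ℕ) (i : Expr)
  | query (a : ℕ) (l : Expr) (b : ℕ)
  | seq (p q : Prog)
  | ite (e : Expr) (p q : Prog)
  | loop (e : Expr) (p : Prog)

/-- Overwrite cell `i` of array `a` with `k`. -/
def Memory.write (m : Memory) (a i k : ℕ) : Memory :=
  fun a' i' => if a' = a ∧ i' = i then k else m a' i'

/-- The bit string held by the first `l` cells of array `a`. -/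
def Memory.bits (m : Memory) (a l : ℕ) : List Bool :=
  (List.range l).map fun i => decide (m a i ≠ 0)

/-- The state of a computation: the memory and the number of coins tossed so far. -/
structure State where
  mem : Memory
  coins : ℕ

open Classical in
/-- `Exec L ω p s s' t`: with oracle `L` and coin tosses `ω 0, ω 1, …`, the program `p`, started in
state `s`, halts in state `s'` after `t` steps. Assignments, coin tosses and tests of conditions
cost one step each, a query costs one step plus the length of the query string. -/
inductive Exec (L : Set (List Bool)) (ω : ℕ → Bool) : Prog → State → State → ℕ → Prop
  | skip (s : State) : Exec L ω .skip s s 1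
  | assign (s : State) (a : ℕ) (i e : Expr) :
      Exec L ω (.assign a i e) s ⟨s.mem.write a (i.eval s.mem) (e.eval s.mem), s.coins⟩ 1
  | flip (s : State) (a : ℕ) (i : Expr) :
      Exec L ω (.flip a i) s
        ⟨s.mem.write a (i.eval s.mem) (if ω s.coins then 1 else 0), s.coins + 1⟩ 1
  | query (s : State) (a : ℕ) (l : Expr) (b : ℕ) :
      Exec L ω (.query a l b) s
        ⟨s.mem.write b 0 (if s.mem.bits a (l.eval s.mem) ∈ L then 1 else 0), s.coins⟩
        (l.eval s.mem + 1)
  | seq (p q : Prog) (s s' s'' : State) (t t' : ℕ) :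
      Exec L ω p s s' t → Exec L ω q s' s'' t' → Exec L ω (.seq p q) s s'' (t + t')
  | ite_true (e : Expr) (p q : Prog) (s s' : State) (t : ℕ) :
      e.eval s.mem ≠ 0 → Exec L ω p s s' t → Exec L ω (.ite e p q) s s' (t + 1)
  | ite_false (e : Expr) (p q : Prog) (s s' : State) (t : ℕ) :
      e.eval s.mem = 0 → Exec L ω q s s' t → Exec L ω (.ite e p q) s s' (t + 1)
  | loop_true (e : Expr) (p : Prog) (s s' s'' : State) (t t' : ℕ) :
      e.eval s.mem ≠ 0 → Exec L ω p s s' t → Exec L ω (.loop e p) s' s'' t' →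
        Exec L ω (.loop e p) s s'' (t + t' + 1)
  | loop_false (e : Expr) (p : Prog) (s : State) :
      e.eval s.mem = 0 → Exec L ω (.loop e p) s s 1

/-! ### The class NP -/

/-- The memory that holds a pair of bit strings: array `0` holds their lengths, arrays `1` and `2`
their bits. All other cells are `0`. -/
def pairMemory (x y : List Bool) : Memory
  | 0 => fun i => [x.length, y.length].getD i 0
  | 1 => fun i => if x.getD i false then 1 else 0
  | 2 => fun i => if y.getD i false then 1 else 0
  | _ => fun _ => 0

/-- `L` is in NP: some deterministic polynomial-time verifier `V` accepts `(x, y)`, for some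
witness `y` of length polynomial in that of `x`, if and only if `x ∈ L`. The verifier runs with the
empty oracle and with all coins equal to `false`, so it is an ordinary deterministic program. It
accepts by halting with a nonzero number in cell `0` of array `0`. -/
def InNP (L : Set (List Bool)) : Prop :=
  ∃ (V : Prog) (c : ℕ),
    (∀ x y : List Bool, ∃ (s : State) (t : ℕ),
      Exec ∅ (fun _ => false) V ⟨pairMemory x y, 0⟩ s t ∧ t ≤ c * (x.length + y.length + 1) ^ c) ∧
    (∀ x : List Bool, x ∈ L ↔
      ∃ y : List Bool, y.length ≤ c * (x.length + 1) ^ c ∧ ∃ (s : State) (t : ℕ),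
        Exec ∅ (fun _ => false) V ⟨pairMemory x y, 0⟩ s t ∧ s.mem 0 0 ≠ 0)

/-! ### Input, output and randomness of the algorithm -/

/-- The memory that holds a circuit and a confidence parameter `r`: array `0` holds the numbers of
inputs and of gates, the output wire and `r`; arrays `1`, `2`, `3` hold, for each gate, its kind and
its entering wires. All other cells are `0`. -/
def inputMemory {n : ℕ} (C : Circuit n) (r : ℕ) : Memory
  | 0 => fun i => [n, C.size, C.output, r].getD i 0
  | 1 => fun j => (C.gates.map Gate.kind).getD j 0
  | 2 => fun j => (C.gates.map Gate.fst).getD j 0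
  | 3 => fun j => (C.gates.map Gate.snd).getD j 0
  | _ => fun _ => 0

/-- The restriction that the algorithm outputs, read from array `0` of the final memory: cell `i`
is `1` if variable `i` is fixed to `false`, `2` if it is fixed to `true`, and anything else if it is
free. -/
def outputRestriction (n : ℕ) (m : Memory) : Restriction n :=
  fun i => if m 0 i = 1 then some false else if m 0 i = 2 then some true else none

/-- The law of an infinite sequence of independent fair coin tosses. -/
noncomputable def coinMeasure : MeasureTheory.Measure (ℕ → Bool) :=
  MeasureTheory.Measure.infinitePi fun _ : ℕ => (PMF.uniformOfFintype Bool).toMeasure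

end Certification

open Certification

/-! Let `S` be the set of variables fixed to `false` so far, initially empty. While `f` takes a
value other than `f 0` at the indicator of a subset of `T = Sᶜ`, shrink `T` to a minimal such
subset, a block, by trying to remove one variable after the other, and add the block to `S`. Every
variable of a block is sensitive at the indicator of the block, so a block has at most `Cert f`
elements. The blocks are disjoint and each of them meets a fixed minimal certificate of `0`, so
there are at most `Cert f` of them, and at most `Cert f ^ 2` variables are fixed in the end. Whether
such a subset exists is a satisfiability question about the circuit, which the oracle answers; no
coins are tossed. -/

namespace Certification

theorem Exec.deterministic {L : Set (List Bool)} {ω : ℕ → Bool} {p : Prog} {s s₁ s₂ : State}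
    {t₁ t₂ : ℕ} (h₁ : Exec L ω p s s₁ t₁) (h₂ : Exec L ω p s s₂ t₂) : s₁ = s₂ ∧ t₁ = t₂ := by
  induction h₁ generalizing s₂ t₂ with
  | skip | assign | flip | query => cases h₂; exact ⟨rfl, rfl⟩
  | seq _ _ _ _ _ _ _ _ _ ihp ihq =>
    cases h₂ with
    | seq _ _ _ _ _ _ _ hp hq =>
      obtain ⟨rfl, rfl⟩ := ihp hp
      obtain ⟨rfl, rfl⟩ := ihq hq
      exact ⟨rfl, rfl⟩
  | ite_true _ _ _ _ _ _ he _ ih | ite_false _ _ _ _ _ _ he _ ih =>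
    cases h₂ with
    | ite_true _ _ _ _ _ _ he' h | ite_false _ _ _ _ _ _ he' h =>
      first
        | contradiction
        | obtain ⟨rfl, rfl⟩ := ih h
          exact ⟨rfl, rfl⟩
  | loop_true _ _ _ _ _ _ _ he _ _ ihp ihq =>
    cases h₂ with
    | loop_true _ _ _ _ _ _ _ _ hp hq =>
      obtain ⟨rfl, rfl⟩ := ihp hp
      obtain ⟨rfl, rfl⟩ := ihq hq
      exact ⟨rfl, rfl⟩
    | loop_false _ _ _ he' => contradiction
  | loop_false _ _ _ he =>
    cases h₂ with
    | loop_true => contradiction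
    | loop_false => exact ⟨rfl, rfl⟩

/-! ### Total correctness with a time bound -/

/-- Total correctness of coin-free programs: with oracle `L` and started with memory `m`, the
program `p` halts within `T` steps, whatever the coins, without tossing any of them, and its final
memory satisfies `Q`. -/
def Runs (L : Set (List Bool)) (p : Prog) (m : Memory) (T : ℕ) (Q : Memory → Prop) : Prop :=
  ∃ (m' : Memory) (t : ℕ), (∀ ω c, Exec L ω p ⟨m, c⟩ ⟨m', c⟩ t) ∧ t ≤ T ∧ Q m'

namespace Runs

variable {L : Set (List Bool)} {p q : Prog} {m : Memory} {T T' : ℕ} {Q Q' R : Memory → Prop}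
  {e : Expr}

theorem mono (h : Runs L p m T Q) (hT : T ≤ T') (hQ : ∀ m', Q m' → Q' m') : Runs L p m T' Q' := by
  obtain ⟨m', t, hp, ht, hq⟩ := h
  exact ⟨m', t, hp, ht.trans hT, hQ m' hq⟩

theorem assign {a : ℕ} {i : Expr} (h : Q (m.write a (i.eval m) (e.eval m))) :
    Runs L (.assign a i e) m 1 Q :=
  ⟨_, _, fun _ _ => .assign _ _ _ _, le_rfl, h⟩

open Classical in
theorem query {a b : ℕ} {l : Expr}
    (h : Q (m.write b 0 (if m.bits a (l.eval m) ∈ L then 1 else 0))) :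
    Runs L (.query a l b) m (l.eval m + 1) Q :=
  ⟨_, _, fun _ _ => .query _ _ _ _, le_rfl, h⟩

theorem seq (hp : Runs L p m T R) (hq : ∀ m', R m' → Runs L q m' T' Q) :
    Runs L (.seq p q) m (T + T') Q := by
  obtain ⟨m', t, hp, ht, hr⟩ := hp
  obtain ⟨m'', t', hq, ht', hq'⟩ := hq m' hr
  exact ⟨m'', t + t', fun ω c => .seq _ _ _ _ _ _ _ (hp ω c) (hq ω c), add_le_add ht ht', hq'⟩

theorem assign_seq {a : ℕ} {i : Expr} (h : Runs L q (m.write a (i.eval m) (e.eval m)) T Q) :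
    Runs L (.seq (.assign a i e) q) m (1 + T) Q :=
  seq (R := (· = m.write a (i.eval m) (e.eval m))) (assign rfl) (by rintro _ rfl; exact h)

theorem ite (hp : e.eval m ≠ 0 → Runs L p m T Q) (hq : e.eval m = 0 → Runs L q m T Q) :
    Runs L (.ite e p q) m (T + 1) Q := by
  by_cases he : e.eval m = 0
  · obtain ⟨m', t, hq, ht, hr⟩ := hq he
    exact ⟨m', t + 1, fun ω c => .ite_false _ _ _ _ _ _ he (hq ω c), by lia, hr⟩
  · obtain ⟨m', t, hp, ht, hr⟩ := hp he
    exact ⟨m', t + 1, fun ω c => .ite_true _ _ _ _ _ _ he (hp ω c), by lia, hr⟩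

theorem loop {α : Type*} {B : ℕ} (I : α → Memory → Prop) (μ : α → ℕ)
    (step : ∀ x m, I x m → e.eval m ≠ 0 → Runs L p m B fun m' => ∃ x', μ x' < μ x ∧ I x' m')
    (x : α) (hx : I x m) :
    Runs L (.loop e p) m (μ x * (B + 1) + 1) fun m' => (∃ x', I x' m') ∧ e.eval m' = 0 := by
  induction h : μ x using Nat.strong_induction_on generalizing x m with
  | _ k ih =>
    subst h
    by_cases he : e.eval m = 0
    · exact ⟨m, 1, fun _ _ => .loop_false _ _ _ he, by lia, ⟨x, hx⟩, he⟩
    · obtain ⟨m', t, hp, ht, x', hlt, hx'⟩ := step x m hx he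
      obtain ⟨m'', t', hl, ht', hq⟩ := ih (μ x') hlt x' hx' rfl
      refine ⟨m'', t + t' + 1, fun ω c => .loop_true _ _ _ _ _ _ _ he (hp ω c) (hl ω c), ?_, hq⟩
      calc t + t' + 1 ≤ (μ x' + 1) * (B + 1) + 1 := by rw [add_one_mul]; lia
        _ ≤ μ x * (B + 1) + 1 := by gcongr; exact hlt

theorem loop_count {B : ℕ} (I : ℕ → Memory → Prop) (N : ℕ)
    (guard : ∀ k m, k ≤ N → I k m → (e.eval m ≠ 0 ↔ k < N))
    (step : ∀ k m, k < N → I k m → Runs L p m B (I (k + 1))) (h0 : I 0 m) :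
    Runs L (.loop e p) m (N * (B + 1) + 1) (I N) := by
  refine (loop (fun k m => k ≤ N ∧ I k m) (N - ·) ?_ 0 ⟨N.zero_le, h0⟩).mono le_rfl ?_
  · rintro k m ⟨hk, hI⟩ he
    have hlt : k < N := (guard k m hk hI).1 he
    exact (step k m hlt hI).mono le_rfl fun m' hI' => ⟨k + 1, by lia, hlt, hI'⟩
  · rintro m' ⟨⟨k, hk, hI⟩, he⟩
    have hkN : k = N := hk.antisymm (not_lt.1 fun hlt => (guard k m' hk hI).2 hlt he)
    exact hkN ▸ hI

end Runs

/-! ### Memory access -/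

namespace Memory

variable (m : Memory) (a i k : ℕ)

@[simp] theorem write_self : m.write a i k a = Function.update (m a) i k := by
  funext j
  by_cases h : j = i <;> simp [write, h]

@[simp] theorem write_of_ne {a' : ℕ} (h : a' ≠ a) : m.write a i k a' = m a' := by
  funext j
  simp [write, h]

variable {m a} in
theorem eqOn_write {m' : Memory} {A : Set ℕ} (h : Set.EqOn m' m Aᶜ) (ha : a ∈ A) :
    Set.EqOn (m'.write a i k) m Aᶜ := fun _ ha' =>
  (write_of_ne _ _ _ _ (ne_of_mem_of_not_mem ha ha').symm).trans (h ha')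

theorem eqOn_trans {m m' m'' : Memory} {A B : Set ℕ} (h : Set.EqOn m'' m' Aᶜ)
    (hm : Set.EqOn m' m Bᶜ) (hAB : A ⊆ B) : Set.EqOn m'' m Bᶜ :=
  (h.mono (Set.compl_subset_compl.2 hAB)).trans hm

/-- The list held by array `a`, whose length is stored in cell `0` of array `l`. -/
def list (l : ℕ) : List ℕ := (List.range (m l 0)).map (m a)

@[simp] theorem length_list (l : ℕ) : (m.list a l).length = m l 0 := by simp [list]

variable {m a i} in
theorem getD_list {l : ℕ} (h : i < m l 0) : (m.list a l).getD i 0 = m a i := by simp [list, h]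

theorem list_push {a l : ℕ} (h : l ≠ a) :
    ((m.write a (m l 0) k).write l 0 (m l 0 + 1)).list a l = m.list a l ++ [k] := by
  simp only [list, write_self, Function.update_self, List.range_succ, List.map_append,
    write_of_ne _ _ _ _ h.symm, List.map_singleton]
  congr 1
  exact List.map_congr_left fun i hi => Function.update_of_ne (List.mem_range.1 hi).ne _ _

theorem bits_eq_map_list (l : ℕ) : m.bits a (m l 0) = (m.list a l).map (decide <| · ≠ 0) := by
  simp [bits, list]

/-- Array `a` holds the indicator function of `S` in its first `n` cells. -/
def HoldsSet {n : ℕ} (S : Finset (Fin n)) : Prop :=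
  ∀ i : Fin n, m a i = (decide (i ∈ S)).toNat

namespace HoldsSet

variable {m a} {n : ℕ} {S : Finset (Fin n)}

theorem congr {m' : Memory} (h : m.HoldsSet a S) (ha : m' a = m a) : m'.HoldsSet a S :=
  fun i => ha ▸ h i

theorem erase (h : m.HoldsSet a S) (i : Fin n) : (m.write a i 0).HoldsSet a (S.erase i) := by
  intro j
  rcases eq_or_ne j i with rfl | hj
  · simp
  · simp [hj, Fin.val_ne_iff.2 hj, h j]

theorem insert (h : m.HoldsSet a S) (i : Fin n) : (m.write a i 1).HoldsSet a (insert i S) := by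
  intro j
  rcases eq_or_ne j i with rfl | hj
  · simp
  · simp [hj, Fin.val_ne_iff.2 hj, h j]

end HoldsSet

end Memory

/-! ### Derived expressions and programs -/

namespace Expr

variable {m : Memory} {e e' : Expr} {x y : Bool}

/-- The first cell of array `a`, used as a scalar variable. -/
abbrev var (a : ℕ) : Expr := .read a (.const 0)

/-- Truth value of `e = k`. -/
def isConst (e : Expr) (k : ℕ) : Expr := .sub (.lt e (.const (k + 1))) (.lt e (.const k))

/-- Negation of a truth value, which must be `0` or `1`. -/
def compl (e : Expr) : Expr := .sub (.const 1) e

/-- Conjunction of two truth values, the first of which must be `0` or `1`. -/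
def inf (e e' : Expr) : Expr := .sub e (.lt e' (.const 1))

/-- Disjunction of two truth values. -/
def sup (e e' : Expr) : Expr := .lt (.const 0) (.add e e')

theorem eval_lt {j k : ℕ} (h : e.eval m = j) (h' : e'.eval m = k) :
    (Expr.lt e e').eval m = (decide (j < k)).toNat := by
  by_cases hjk : j < k <;> simp [eval, h, h', hjk]

theorem eval_isConst {j : ℕ} (h : e.eval m = j) (k : ℕ) :
    (e.isConst k).eval m = (decide (j = k)).toNat := by
  simp only [isConst, eval, h, Bool.toNat, cond_eq_ite, decide_eq_true_eq]
  split_ifs <;> lia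

theorem eval_compl (h : e.eval m = x.toNat) : e.compl.eval m = (!x).toNat := by
  cases x <;> simp [compl, eval, h]

theorem eval_inf (h : e.eval m = x.toNat) (h' : e'.eval m = y.toNat) :
    (e.inf e').eval m = (x && y).toNat := by
  cases x <;> cases y <;> simp [inf, eval, h, h']

theorem eval_sup (h : e.eval m = x.toNat) (h' : e'.eval m = y.toNat) :
    (e.sup e').eval m = (x || y).toNat := by
  cases x <;> cases y <;> simp [sup, eval, h, h']

end Expr

namespace Prog

/-- Assignment to the scalar variable `a`. -/
abbrev set (a : ℕ) (e : Expr) : Prog := .assign a (.const 0) e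

/-- Appends the value of `e` to the list in array `a`, whose length is in `l`. -/
def push (a l : ℕ) (e : Expr) : Prog :=
  .seq (.assign a (.var l) e) (.set l (.add (.var l) (.const 1)))

/-- Runs `p` for all values `0, …, N - 1` of the variable `i`, where `N` is the value of the
variable `b`. -/
def forLoop (i b : ℕ) (p : Prog) : Prog :=
  .seq (.set i (.const 0)) <|
  .loop (.lt (.var i) (.var b)) <| .seq p (.set i (.add (.var i) (.const 1)))

/-- Sets cell `i` of array `a` to the value of `e`, which may depend on the variable `i`, for all
`i` below the value of the variable `b`. -/
def fill (i b a : ℕ) (e : Expr) : Prog := forLoop i b (.assign a (.var i) e)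

end Prog

namespace Runs

variable {L : Set (List Bool)} {p : Prog} {m : Memory} {e : Expr} {a i b l : ℕ}

theorem push (h : l ≠ a) : Runs L (.push a l e) m 2 fun m' =>
    Set.EqOn m' m {a, l}ᶜ ∧ m'.list a l = m.list a l ++ [e.eval m] := by
  refine assign_seq (assign ⟨?_, ?_⟩)
  · exact Memory.eqOn_write _ _ (Memory.eqOn_write _ _ (Set.eqOn_refl _ _) (by simp)) (by simp)
  · simpa [Expr.eval, h] using m.list_push (e.eval m) h

theorem forLoop {B : ℕ} (I : ℕ → Memory → Prop) (h0 : I 0 (m.write i 0 0)) (N : ℕ)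
    (bound : ∀ k m, I k m → m b 0 = N)
    (step : ∀ k m, k < N → I k m → m i 0 = k →
      Runs L p m B fun m' => m' i 0 = k ∧ I (k + 1) (m'.write i 0 (k + 1))) :
    Runs L (.forLoop i b p) m (N * (B + 2) + 2) (I N) := by
  refine (assign_seq <| loop_count (B := B + 1) (fun k m' => m' i 0 = k ∧ I k m') N ?_ ?_ ?_).mono
    (by lia) fun _ h => h.2
  · rintro k m' - ⟨hi, hI⟩
    simp [Expr.eval, hi, bound k m' hI]
  · rintro k m' hk ⟨hi, hI⟩
    refine (step k m' hk hI hi).seq fun m'' ⟨hi', hI'⟩ => assign ⟨?_, ?_⟩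
    · simp [Expr.eval, hi']
    · simpa [Expr.eval, hi'] using hI'
  · exact ⟨by simp [Expr.eval], h0⟩

theorem fill {n : ℕ} {S : Finset (Fin n)} (ha : a ≠ i) (hb : b ∉ ({i, a} : Set ℕ))
    (hn : m b 0 = n) (he : ∀ (k : Fin n) (m' : Memory), Set.EqOn m' m {i, a}ᶜ → m' a k = m a k →
      m' i 0 = k → e.eval m' = (decide (k ∈ S)).toNat) :
    Runs L (.fill i b a e) m (n * 3 + 2) fun m' =>
      Set.EqOn m' m {i, a}ᶜ ∧ m'.HoldsSet a S := by
  refine (forLoop (B := 1) (fun k m' => Set.EqOn m' m {i, a}ᶜ ∧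
    (∀ j : Fin n, j < k → m' a j = (decide (j ∈ S)).toNat) ∧ ∀ j, k ≤ j → m' a j = m a j)
    ?_ n ?_ ?_).mono le_rfl fun _ h => ⟨h.1, fun j => h.2.1 j j.isLt⟩
  · exact ⟨Memory.eqOn_write _ _ (Set.eqOn_refl _ _) (by simp), by simp, by simp [ha]⟩
  · exact fun k m' h => by rw [h.1 hb, hn]
  · rintro k m' hk ⟨hf, hlt, hge⟩ hi
    have hek := he ⟨k, hk⟩ m' hf (hge k le_rfl) hi
    have hw : (m'.write a (m' i 0) (e.eval m')) a =
        Function.update (m' a) k (decide (⟨k, hk⟩ ∈ S)).toNat := by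
      rw [Memory.write_self, hi, hek]
    refine assign ⟨by simp [ha.symm, hi], ?_, fun j hj => ?_, fun j hj => ?_⟩
    · exact Memory.eqOn_write _ _ (Memory.eqOn_write _ _ hf (by simp)) (by simp)
    · rw [Memory.write_of_ne _ _ _ _ ha, Expr.eval, Expr.eval, hw]
      rcases Nat.lt_succ_iff_lt_or_eq.1 hj with hj | rfl
      · rw [Function.update_of_ne hj.ne, hlt j hj]
      · rw [Function.update_self]
    · rw [Memory.write_of_ne _ _ _ _ ha, Expr.eval, Expr.eval, hw,
        Function.update_of_ne (Nat.lt_of_succ_le hj).ne', hge j (Nat.le_of_succ_le hj)]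

end Runs

/-! ### Certificates and minimal deviating sets -/

section Combinatorics

variable {n : ℕ} {f : (Fin n → Bool) → Bool} {x y : Fin n → Bool} {b : Bool}
  {S T Z : Finset (Fin n)} {k : ℕ}

theorem exists_isCertificate_card_le (f : (Fin n → Bool) → Bool) (x : Fin n → Bool) :
    ∃ Z, IsCertificate f x Z ∧ Z.card ≤ cert f := by
  obtain ⟨Z, hZ, hcard⟩ : certAt f x ∈ {k | ∃ Z, IsCertificate f x Z ∧ Z.card = k} :=
    Nat.sInf_mem ⟨_, Finset.univ, fun y hy => by rw [funext fun i => hy i (Finset.mem_univ i)], rfl⟩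
  exact ⟨Z, hZ, hcard.trans_le (Finset.le_sup (Finset.mem_univ x))⟩

theorem IsCertificate.exists_ne (hZ : IsCertificate f x Z) (h : f y ≠ f x) :
    ∃ i ∈ Z, y i ≠ x i := by
  by_contra! hy
  exact h (hZ y hy)

theorem card_sensitive_le_cert
    (h : ∀ i ∈ T, f (Function.update x i (!x i)) ≠ f x) : T.card ≤ cert f := by
  obtain ⟨Z, hZ, hcard⟩ := exists_isCertificate_card_le f x
  refine (Finset.card_le_card fun i hi => ?_).trans hcard
  obtain ⟨j, hj, hne⟩ := hZ.exists_ne (h i hi)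
  rwa [← of_not_not fun hji : j ≠ i => hne (Function.update_of_ne hji _ _)]

/-- The input that is `true` exactly on `S`. -/
def indicator (S : Finset (Fin n)) : Fin n → Bool := fun i => decide (i ∈ S)

theorem indicator_erase {i : Fin n} (hi : i ∈ S) :
    indicator (S.erase i) = Function.update (indicator S) i (!indicator S i) := by
  funext j
  rcases eq_or_ne j i with rfl | hj <;> simp [indicator, *]

/-- Some input supported on `T` is not mapped to `b`. -/
def Deviates (f : (Fin n → Bool) → Bool) (b : Bool) (T : Finset (Fin n)) : Prop :=
  ∃ Y ⊆ T, f (indicator Y) ≠ b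

instance : Decidable (Deviates f b T) := inferInstanceAs (Decidable (∃ Y ⊆ T, f (indicator Y) ≠ b))

theorem deviates_empty : Deviates f b ∅ ↔ f (indicator ∅) ≠ b := by
  simp [Deviates, Finset.subset_empty]

theorem Deviates.mono (h : Deviates f b S) (hST : S ⊆ T) : Deviates f b T :=
  h.imp fun _ hY => hY.imp_left (·.trans hST)

/-- A minimal sensitive block of `f` at the zero input. -/
def IsMinBlock (f : (Fin n → Bool) → Bool) (T : Finset (Fin n)) : Prop :=
  Minimal (fun Y => f (indicator Y) ≠ f (indicator ∅)) T

/-- All coordinates of a minimal block are sensitive at its indicator, since removing any one of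
them restores the value at zero. -/
theorem IsMinBlock.card_le (hT : IsMinBlock f T) : T.card ≤ cert f := by
  refine card_sensitive_le_cert (x := indicator T) fun i hi => ?_
  rw [← indicator_erase hi, of_not_not (hT.not_prop_of_lt (Finset.erase_ssubset hi))]
  exact hT.prop.symm

theorem IsMinBlock.ne_empty (hT : IsMinBlock f T) : T ≠ ∅ := by
  rintro rfl
  exact hT.prop rfl

theorem IsMinBlock.inter_nonempty (hT : IsMinBlock f T) (hZ : IsCertificate f (indicator ∅) Z) :
    (T ∩ Z).Nonempty := by
  obtain ⟨i, hi, hne⟩ := hZ.exists_ne hT.prop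
  exact ⟨i, Finset.mem_inter.2 ⟨by simpa [indicator] using hne, hi⟩⟩

/-- The invariant of the greedy search for a minimal block: `T` contains a deviating set, and none
of its elements below `k` can be spared. -/
structure IsIrredundantBelow (f : (Fin n → Bool) → Bool) (k : ℕ) (T : Finset (Fin n)) : Prop where
  deviates : Deviates f (f (indicator ∅)) T
  not_deviates_erase : ∀ i ∈ T, (i : ℕ) < k → ¬Deviates f (f (indicator ∅)) (T.erase i)

namespace IsIrredundantBelow

theorem zero (h : Deviates f (f (indicator ∅)) T) : IsIrredundantBelow f 0 T :=
  ⟨h, fun _ _ hi => absurd hi (Nat.not_lt_zero _)⟩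

theorem erase {i : Fin n} (h : IsIrredundantBelow f i T)
    (hd : Deviates f (f (indicator ∅)) (T.erase i)) : IsIrredundantBelow f (i + 1) (T.erase i) := by
  refine ⟨hd, fun j hj hlt hdj => ?_⟩
  obtain ⟨hji, hjT⟩ := Finset.mem_erase.1 hj
  have hj_lt : (j : ℕ) < i := (Nat.lt_succ_iff.1 hlt).lt_of_ne (Fin.val_ne_iff.2 hji)
  exact h.not_deviates_erase j hjT hj_lt (hdj.mono (Finset.erase_subset_erase _ (T.erase_subset i)))

theorem keep {i : Fin n} (h : IsIrredundantBelow f i T)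
    (hd : ¬Deviates f (f (indicator ∅)) (T.erase i)) : IsIrredundantBelow f (i + 1) T := by
  refine ⟨h.deviates, fun j hj hlt => ?_⟩
  rcases Nat.lt_succ_iff_lt_or_eq.1 hlt with hlt | hji
  · exact h.not_deviates_erase j hj hlt
  · rwa [Fin.ext hji]

theorem isMinBlock (h : IsIrredundantBelow f n T) : IsMinBlock f T := by
  have eq_of_subset : ∀ Y ⊆ T, f (indicator Y) ≠ f (indicator ∅) → Y = T := by
    refine fun Y hY hfY => hY.antisymm fun i hi => ?_
    by_contra hiY
    exact h.not_deviates_erase i hi i.isLt ⟨Y, Finset.subset_erase.2 ⟨hY, hiY⟩, hfY⟩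
  obtain ⟨Y, hY, hfY⟩ := h.deviates
  exact ⟨eq_of_subset Y hY hfY ▸ hfY, fun Y hfY hY => (eq_of_subset Y hY hfY).ge⟩

end IsIrredundantBelow

/-- Disjoint unions of minimal blocks: the sets of variables that the algorithm may fix. -/
inductive IsBlockUnion (f : (Fin n → Bool) → Bool) : Finset (Fin n) → Prop
  | empty : IsBlockUnion f ∅
  | union {S T : Finset (Fin n)} :
      IsBlockUnion f S → Disjoint S T → IsMinBlock f T → IsBlockUnion f (S ∪ T)

/-- The blocks are disjoint and each of them meets one fixed certificate of zero, so there are at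
most `cert f` of them. -/
theorem IsBlockUnion.card_le (hS : IsBlockUnion f S) : S.card ≤ cert f ^ 2 := by
  obtain ⟨Z, hZ, hcard⟩ := exists_isCertificate_card_le f (indicator ∅)
  have hSZ : S.card ≤ cert f * (S ∩ Z).card := by
    induction hS with
    | empty => simp
    | @union S T _ hST hT ih =>
      have hTZ : 1 ≤ (T ∩ Z).card := (hT.inter_nonempty hZ).card_pos
      calc (S ∪ T).card = S.card + T.card := Finset.card_union_of_disjoint hST
        _ ≤ cert f * (S ∩ Z).card + cert f * (T ∩ Z).card :=
          add_le_add ih (hT.card_le.trans (Nat.le_mul_of_pos_right _ hTZ))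
        _ = cert f * ((S ∪ T) ∩ Z).card := by
          rw [← mul_add, Finset.union_inter_distrib_right, Finset.card_union_of_disjoint]
          exact hST.mono Finset.inter_subset_left Finset.inter_subset_left
  calc S.card ≤ cert f * (S ∩ Z).card := hSZ
    _ ≤ cert f * cert f := by grw [Finset.inter_subset_right, hcard]
    _ = cert f ^ 2 := (sq _).symm

/-- The restriction that fixes the variables in `S` to `false`. -/
def zeroOn (S : Finset (Fin n)) : Restriction n := fun i => if i ∈ S then some false else none

theorem length_zeroOn (S : Finset (Fin n)) : (zeroOn S).length = S.card := by
  simp [Restriction.length, zeroOn, apply_ite Option.isSome]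

theorem isConstant_restrict_zeroOn (h : ¬Deviates f b Sᶜ) : IsConstant (restrict f (zeroOn S)) := by
  refine ⟨b, fun x => by_contra fun hx => h ⟨{i ∈ Sᶜ | x i}, Finset.filter_subset _ _, ?_⟩⟩
  convert hx using 1
  refine congrArg f (funext fun i => ?_)
  by_cases hi : i ∈ S <;> simp [indicator, zeroOn, hi]

theorem outputRestriction_eq_zeroOn {m : Memory} (h : m.HoldsSet 0 S) :
    outputRestriction n m = zeroOn S := by
  funext i
  by_cases hi : i ∈ S <;> simp [outputRestriction, zeroOn, h i, hi]

end Combinatorics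

/-! ### Coded circuits -/

/-- One step of the decoder for the unary code. Its state is the list of complete numbers together
with the number of ones read since the last zero. -/
def unaryStep : List ℕ × ℕ → Bool → List ℕ × ℕ
  | (D, k), true => (D, k + 1)
  | (D, k), false => (D ++ [k], 0)

/-- The list of numbers coded by a bit string; ones after the last zero are ignored. -/
def unaryDecode (x : List Bool) : List ℕ := (x.foldl unaryStep ([], 0)).1

/-- The unary code of a list of numbers, in which every number `k` becomes `k` ones and a zero. -/
def unaryEncode (D : List ℕ) : List Bool := D.flatMap fun k => List.replicate k true ++ [false]

theorem foldl_unaryStep_replicate (D : List ℕ) (j k : ℕ) :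
    (List.replicate k true).foldl unaryStep (D, j) = (D, j + k) := by
  induction k generalizing j with
  | zero => rfl
  | succ k ih => rw [List.replicate_succ, List.foldl_cons, unaryStep, ih, Nat.add_right_comm]; rfl

theorem unaryDecode_unaryEncode (D : List ℕ) : unaryDecode (unaryEncode D) = D := by
  suffices ∀ D', (unaryEncode D).foldl unaryStep (D', 0) = (D' ++ D, 0) by
    simp [unaryDecode, this]
  intro D'
  induction D generalizing D' with
  | nil => simp [unaryEncode]
  | cons k D ih =>
    have hcons : unaryEncode (k :: D) = List.replicate k true ++ false :: unaryEncode D := by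
      simp [unaryEncode]
    rw [hcons, List.foldl_append, foldl_unaryStep_replicate, List.foldl_cons, unaryStep, ih,
      List.append_assoc, List.singleton_append, Nat.zero_add]

theorem length_unaryDecode_le (x : List Bool) : (unaryDecode x).length ≤ x.length := by
  induction x using List.reverseRecOn with
  | nil => rfl
  | append_singleton x b ih =>
    rw [unaryDecode] at ih ⊢
    cases b <;> simp [unaryStep] <;> lia

/-- A gate of a coded circuit. The kinds `0`, …, `4` are those of `Gate.kind`; a gate of kind `5` is
an input bit. There is no bound on the entering wires: a wire that does not exist carries
`false`. -/
structure GateCode where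
  kind : ℕ
  fst : ℕ
  snd : ℕ

namespace GateCode

/-- The three numbers that describe a gate. -/
def toList (g : GateCode) : List ℕ := [g.kind, g.fst, g.snd]

/-- The gates described by consecutive triples of numbers; an incomplete triple at the end is
ignored. -/
def ofList : List ℕ → List GateCode
  | k :: u :: v :: D => ⟨k, u, v⟩ :: ofList D
  | _ => []

theorem ofList_flatMap_toList (τ : List GateCode) : ofList (τ.flatMap toList) = τ := by
  induction τ with
  | nil => rfl
  | cons g τ ih => simp [toList, ofList, ih]

theorem getElem?_ofList (D : List ℕ) (k : ℕ) : (ofList D)[k]? =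
    if 3 * k + 2 < D.length then
      some ⟨D.getD (3 * k) 0, D.getD (3 * k + 1) 0, D.getD (3 * k + 2) 0⟩
    else none := by
  induction D using ofList.induct generalizing k with
  | case1 a u v D ih =>
    cases k with
    | zero => simp [ofList]
    | succ k => simp [ofList, ih, Nat.mul_succ]; rfl
  | case2 D h =>
    match D, h with
    | [], _ | [_], _ | [_, _], _ => simp [ofList]
    | a :: u :: v :: D, h => exact absurd rfl (h a u v D)

theorem lt_length_ofList {D : List ℕ} {k : ℕ} : k < (ofList D).length ↔ 3 * k + 2 < D.length := by
  rw [← not_le, ← List.getElem?_eq_none_iff, getElem?_ofList]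
  simp

/-- The value of a coded gate when the wires carry the values `w` and its input bit is `b`. -/
def eval (w : ℕ → Bool) (b : Bool) (g : GateCode) : Bool :=
  decide (g.kind = 1) || (decide (g.kind = 2) && !(w g.fst)) ||
    (decide (g.kind = 3) && (w g.fst && w g.snd)) ||
    (decide (g.kind = 4) && (w g.fst || w g.snd)) || (decide (g.kind = 5) && b)

/-- The values of all wires of a coded circuit. The bits of `y` are assigned to all gates in order,
but only those of kind `5` look at them. -/
def wires (y : List Bool) (τ : List GateCode) : List Bool :=
  τ.foldl (fun v g => v ++ [g.eval (v.getD · false) (y.getD v.length false)]) []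

theorem wires_append_singleton (y : List Bool) (τ : List GateCode) (g : GateCode) :
    wires y (τ ++ [g]) =
      wires y τ ++ [g.eval ((wires y τ).getD · false) (y.getD (wires y τ).length false)] := by
  simp only [wires, List.foldl_append, List.foldl_cons, List.foldl_nil]

theorem length_wires (y : List Bool) (τ : List GateCode) : (wires y τ).length = τ.length := by
  induction τ using List.reverseRecOn with
  | nil => rfl
  | append_singleton τ g ih => simp [wires_append_singleton, ih]

/-- The value of the last wire. -/
def output (y : List Bool) (τ : List GateCode) : Bool := (wires y τ).getD (τ.length - 1) false

/-- The bit string that represents a coded circuit in an instance of `circuitSat`. -/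
def encode (τ : List GateCode) : List Bool := unaryEncode (τ.flatMap toList)

/-- The coded circuit represented by a bit string; every bit string represents one. -/
def decode (x : List Bool) : List GateCode := ofList (unaryDecode x)

theorem decode_encode (τ : List GateCode) : decode (encode τ) = τ := by
  rw [decode, encode, unaryDecode_unaryEncode, ofList_flatMap_toList]

theorem length_le_length_encode (τ : List GateCode) : τ.length ≤ (encode τ).length := by
  induction τ with
  | nil => simp
  | cons g τ ih =>
    simp only [encode, unaryEncode, toList, List.flatMap_cons, List.flatMap_append,
      List.length_append, List.length_cons, List.length_replicate] at ih ⊢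
    lia

end GateCode

/-- The satisfiability problem for coded circuits. -/
def circuitSat : Set (List Bool) :=
  {x | ∃ y : List Bool, y.length ≤ x.length ∧ GateCode.output y (GateCode.decode x)}

theorem encode_mem_circuitSat {τ : List GateCode} : GateCode.encode τ ∈ circuitSat ↔
    ∃ y : List Bool, y.length ≤ (GateCode.encode τ).length ∧ GateCode.output y τ := by
  simp only [circuitSat, Set.mem_ofPred_eq, GateCode.decode_encode]

/-! ### The verifier -/

namespace Verifier

abbrev bits : ℕ := 1
abbrev witness : ℕ := 2
abbrev nums : ℕ := 3
abbrev numsLen : ℕ := 4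
abbrev pending : ℕ := 5
abbrev pos : ℕ := 6
abbrev wires : ℕ := 7
abbrev wiresLen : ℕ := 8

open Certification.Expr (var)

def decodeStep : Prog :=
  .ite (.read bits (var pos)) (.set pending (.add (var pending) (.const 1)))
    (.seq (.push nums numsLen (var pending)) (.set pending (.const 0)))

/-- Decodes the input into the array `nums`. -/
def decodeProg : Prog :=
  .seq (.set numsLen (.const 0)) <| .seq (.set pending (.const 0)) <| .forLoop pos 0 decodeStep

/-- The value of wire `i`, or `0` if it does not exist. -/
def wireExpr (i : Expr) : Expr := (Expr.lt i (var wiresLen)).inf (.read wires i)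

/-- The value of the gate whose code starts at position `pos`. -/
def gateExpr : Expr :=
  let kind := Expr.read nums (var pos)
  let fst := wireExpr (.read nums (.add (var pos) (.const 1)))
  let snd := wireExpr (.read nums (.add (var pos) (.const 2)))
  ((((kind.isConst 1).sup ((kind.isConst 2).inf fst.compl)).sup
    ((kind.isConst 3).inf (fst.inf snd))).sup
    ((kind.isConst 4).inf (fst.sup snd))).sup
    ((kind.isConst 5).inf (.read witness (var wiresLen)))

def evalStep : Prog :=
  .seq (.push wires wiresLen gateExpr) (.set pos (.add (var pos) (.const 3)))

/-- Evaluates the coded circuit described by the array `nums`, with input bits from the witness. -/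
def evalProg : Prog :=
  .seq (.set wiresLen (.const 0)) <| .seq (.set pos (.const 0)) <|
  .loop (.lt (.add (var pos) (.const 2)) (var numsLen)) evalStep

/-- The verifier for `circuitSat`. Witnesses longer than the input are rejected. -/
def prog : Prog :=
  .seq decodeProg <| .seq evalProg <|
  .set 0 <| (Expr.lt (var 0) (.read 0 (.const 1))).compl.inf
    (wireExpr (.sub (var wiresLen) (.const 1)))

variable {m : Memory} {x y v : List Bool}

theorem runs_decodeStep {b : Bool} (hb : m bits (m pos 0) = b.toNat) :
    Runs ∅ decodeStep m 4 fun m' => Set.EqOn m' m {nums, numsLen, pending}ᶜ ∧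
      (m'.list nums numsLen, m' pending 0) = unaryStep (m.list nums numsLen, m pending 0) b := by
  refine Runs.ite (T := 2 + 1) (fun he => ?_) fun he => ?_
  · have hb : b = true := by simpa [Expr.eval, hb] using he
    refine (Runs.assign ⟨?_, ?_⟩).mono (by lia) fun _ h => h
    · exact Memory.eqOn_write _ _ (Set.eqOn_refl _ _) (by simp)
    · simp [hb, Memory.list, unaryStep, Expr.eval]
  · have hb : b = false := by simpa [Expr.eval, hb] using he
    refine (Runs.push (by simp)).seq fun m' ⟨hf, hl⟩ => Runs.assign ⟨?_, ?_⟩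
    · exact Memory.eqOn_write _ _ (hf.mono (by simp)) (by simp)
    · simpa [hb, Memory.list, unaryStep, Expr.eval] using hl

theorem runs_decodeProg (h0 : m 0 0 = x.length) (hbits : ∀ i, m bits i = (x.getD i false).toNat) :
    Runs ∅ decodeProg m (6 * x.length + 4) fun m' =>
      Set.EqOn m' m {nums, numsLen, pending, pos}ᶜ ∧ m'.list nums numsLen = unaryDecode x := by
  let I (k : ℕ) (m' : Memory) : Prop := Set.EqOn m' m {nums, numsLen, pending, pos}ᶜ ∧
    (m'.list nums numsLen, m' pending 0) = (x.take k).foldl unaryStep ([], 0)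
  have hI : ∀ k (m' : Memory) j, I k m' → I k (m'.write pos 0 j) := by
    rintro k m' j ⟨hf, hl⟩
    exact ⟨Memory.eqOn_write _ _ hf (by simp), by simpa [Memory.list] using hl⟩
  refine (Runs.assign_seq <| Runs.assign_seq <| Runs.forLoop (B := 4) I (hI _ _ _ ⟨?_, ?_⟩)
    x.length ?_ ?_).mono (by lia) ?_
  · exact Memory.eqOn_write _ _ (Memory.eqOn_write _ _ (Set.eqOn_refl _ _) (by simp)) (by simp)
  · simp [Memory.list, Expr.eval]
  · rintro k m' ⟨hf, -⟩
    rw [hf (by simp), h0]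
  · rintro k m' hk ⟨hf, hl⟩ hpos
    have hbit : m' bits (m' pos 0) = x[k].toNat := by
      rw [hf (by simp), hbits, hpos, List.getD_eq_getElem _ _ hk]
    refine (runs_decodeStep hbit).mono le_rfl fun m'' ⟨hf', hl'⟩ =>
      ⟨by rw [hf' (by simp), hpos], hI _ _ _
        ⟨Memory.eqOn_trans hf' hf (by simp [Set.insert_subset_iff]), ?_⟩⟩
    rw [hl', hl, List.take_add_one, List.getElem?_eq_getElem hk, List.foldl_append]
    rfl
  · rintro m' ⟨hf, hl⟩
    exact ⟨hf, by rw [unaryDecode, ← x.take_length, ← hl]⟩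

theorem eval_wireExpr {i : Expr} (hv : m.list wires wiresLen = v.map Bool.toNat) :
    (wireExpr i).eval m = (v.getD (i.eval m) false).toNat := by
  have hlen : m wiresLen 0 = v.length := by simpa using congrArg List.length hv
  by_cases hi : i.eval m < v.length
  · have hread : m wires (i.eval m) = (v[i.eval m]).toNat := by
      rw [← Memory.getD_list (m := m) (a := wires) (l := wiresLen) (hlen ▸ hi), hv]; simp [hi]
    cases h : v[i.eval m] <;> simp [wireExpr, Expr.inf, Expr.eval, hlen, hi, hread, h]
  · simp [wireExpr, Expr.inf, Expr.eval, hlen, hi]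

theorem eval_gateExpr {g : GateCode} (hv : m.list wires wiresLen = v.map Bool.toNat)
    (hy : ∀ i, m witness i = (y.getD i false).toNat) (hkind : m nums (m pos 0) = g.kind)
    (hfst : m nums (m pos 0 + 1) = g.fst) (hsnd : m nums (m pos 0 + 2) = g.snd) :
    gateExpr.eval m = (g.eval (v.getD · false) (y.getD v.length false)).toNat := by
  have hlen : m wiresLen 0 = v.length := by simpa using congrArg List.length hv
  have hw (c k : ℕ) (h : m nums (m pos 0 + c) = k) :
      (wireExpr (.read nums (.add (var pos) (.const c)))).eval m = (v.getD k false).toNat := by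
    rw [eval_wireExpr hv, ← h]; rfl
  have hu := hw 1 _ hfst
  have hv := hw 2 _ hsnd
  have hy : (Expr.read witness (var wiresLen)).eval m = (y.getD v.length false).toNat := by
    rw [← hlen, ← hy]; rfl
  have hk := Expr.eval_isConst (m := m) (e := .read nums (var pos)) hkind
  exact Expr.eval_sup (Expr.eval_sup (Expr.eval_sup
    (Expr.eval_sup (hk 1) (Expr.eval_inf (hk 2) (Expr.eval_compl hu)))
    (Expr.eval_inf (hk 3) (Expr.eval_inf hu hv))) (Expr.eval_inf (hk 4) (Expr.eval_sup hu hv)))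
    (Expr.eval_inf (hk 5) hy)

theorem runs_evalStep {g : GateCode} (hv : m.list wires wiresLen = v.map Bool.toNat)
    (hy : ∀ i, m witness i = (y.getD i false).toNat) (hkind : m nums (m pos 0) = g.kind)
    (hfst : m nums (m pos 0 + 1) = g.fst) (hsnd : m nums (m pos 0 + 2) = g.snd) :
    Runs ∅ evalStep m 3 fun m' =>
      Set.EqOn m' m {wires, wiresLen, pos}ᶜ ∧ m' pos 0 = m pos 0 + 3 ∧ m'.list wires wiresLen =
        (v ++ [g.eval (v.getD · false) (y.getD v.length false)]).map Bool.toNat := by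
  refine (Runs.push (by simp)).seq (T' := 1) fun m' h => Runs.assign ⟨?_, ?_, ?_⟩
  · exact Memory.eqOn_write _ _ (Memory.eqOn_trans h.1 (Set.eqOn_refl _ _) (by simp)) (by simp)
  · simp [Expr.eval, h.1 (x := pos) (by simp)]
  · rw [eval_gateExpr hv hy hkind hfst hsnd, hv] at h
    simpa [Memory.list] using h.2

theorem runs_evalProg {D : List ℕ} (hy : ∀ i, m witness i = (y.getD i false).toNat)
    (hD : m.list nums numsLen = D) :
    Runs ∅ evalProg m (4 * D.length + 3) fun m' =>
      Set.EqOn m' m {wires, wiresLen, pos}ᶜ ∧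
        m'.list wires wiresLen = (GateCode.wires y (GateCode.ofList D)).map Bool.toNat := by
  have hlen : m numsLen 0 = D.length := by simpa using congrArg List.length hD
  have hnums (i : ℕ) (hi : i < D.length) : m nums i = D.getD i 0 := by
    rw [← hD, Memory.getD_list (hlen ▸ hi)]
  refine (Runs.assign_seq <| Runs.assign_seq <| Runs.loop_count (B := 3)
    (fun k m' => Set.EqOn m' m {wires, wiresLen, pos}ᶜ ∧ m' pos 0 = 3 * k ∧
      m'.list wires wiresLen = (GateCode.wires y ((GateCode.ofList D).take k)).map Bool.toNat)
    (GateCode.ofList D).length ?_ ?_ ?_).mono ?_ ?_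
  · rintro k m' - ⟨hf, hpos, -⟩
    simp [Expr.eval, hpos, hf (x := numsLen) (by simp), hlen, GateCode.lt_length_ofList]
  · rintro k m' hk ⟨hf, hpos, hv⟩
    have hk' : 3 * k + 2 < D.length := GateCode.lt_length_ofList.1 hk
    have hg := (GateCode.getElem?_ofList D k).trans (if_pos hk')
    have hn (i : ℕ) (hi : i < D.length) : m' nums i = D.getD i 0 :=
      (congrFun (hf (by simp)) i).trans (hnums i hi)
    have hy' (i : ℕ) : m' witness i = (y.getD i false).toNat :=
      (congrFun (hf (by simp)) i).trans (hy i)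
    rw [← hpos] at hg hk'
    refine (runs_evalStep (g := ⟨_, _, _⟩) hv hy' (hn _ (by lia)) (hn _ (by lia)) (hn _ hk')).mono
      le_rfl ?_
    rintro m'' ⟨hf', hpos', hv'⟩
    refine ⟨hf'.trans hf, by lia, ?_⟩
    rw [hv', List.take_add_one, hg]
    exact congrArg _ (GateCode.wires_append_singleton _ _ _).symm
  · refine ⟨Memory.eqOn_write _ _ (Memory.eqOn_write _ _ (Set.eqOn_refl _ _) (by simp)) (by simp),
      by simp [Expr.eval], by simp [Memory.list, Expr.eval, GateCode.wires]⟩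
  · have : 3 * (GateCode.ofList D).length ≤ D.length := by
      have := GateCode.lt_length_ofList (D := D) (k := (GateCode.ofList D).length - 1)
      lia
    lia
  · rintro m' ⟨hf, -, hv⟩
    exact ⟨hf, by rwa [List.take_length] at hv⟩

theorem runs_prog (x y : List Bool) :
    Runs ∅ prog (pairMemory x y) (10 * x.length + 8) fun m' =>
      m' 0 0 = (decide (y.length ≤ x.length) && GateCode.output y (GateCode.decode x)).toNat := by
  have hbits (i : ℕ) : pairMemory x y bits i = (x.getD i false).toNat := by
    rw [Bool.toNat, cond_eq_ite]; rfl
  have hwitness (i : ℕ) : pairMemory x y witness i = (y.getD i false).toNat := by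
    rw [Bool.toNat, cond_eq_ite]; rfl
  refine ((runs_decodeProg rfl hbits).seq fun m₁ ⟨hf₁, hD⟩ => (runs_evalProg
    (fun i => (congrFun (hf₁ (by simp)) i).trans (hwitness i)) hD).seq (T' := 1) fun m₂ ⟨hf₂, hv⟩ =>
    Runs.assign ?_).mono (by grind [length_unaryDecode_le x]) fun _ h => h
  have hlen : m₂ wiresLen 0 = (GateCode.decode x).length := by
    simpa [GateCode.length_wires, GateCode.decode] using congrArg List.length hv
  have h0 : m₂ 0 = pairMemory x y 0 := (hf₂ (by simp)).trans (hf₁ (by simp))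
  have hlt : (Expr.lt (var 0) (.read 0 (.const 1))).eval m₂ =
      (decide (x.length < y.length)).toNat :=
    Expr.eval_lt (congrFun h0 0) (congrFun h0 1)
  have hout : (wireExpr (.sub (var wiresLen) (.const 1))).eval m₂ =
      (GateCode.output y (GateCode.decode x)).toNat := by
    rw [eval_wireExpr hv, GateCode.output, ← hlen]; rfl
  rw [Memory.write_self, Expr.eval, Function.update_self,
    Expr.eval_inf (Expr.eval_compl hlt) hout]
  simp only [← decide_not, not_lt]

end Verifier

theorem circuitSat_inNP : InNP circuitSat := by
  have accepts_iff (x y : List Bool) :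
      (∃ (s : State) (t : ℕ), Exec ∅ (fun _ => false) Verifier.prog ⟨pairMemory x y, 0⟩ s t ∧
        s.mem 0 0 ≠ 0) ↔ y.length ≤ x.length ∧ GateCode.output y (GateCode.decode x) := by
    obtain ⟨m', t, hp, -, hm'⟩ := Verifier.runs_prog x y
    rw [← decide_eq_true_iff (p := y.length ≤ x.length), ← Bool.and_eq_true, ← Bool.toNat_eq_one,
      ← hm']
    refine ⟨fun ⟨s, t', hs, hne⟩ => ?_, fun h => ⟨_, t, hp _ 0, h.trans_ne one_ne_zero⟩⟩
    obtain ⟨rfl, -⟩ := (hp _ 0).deterministic hs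
    exact (hm' ▸ Bool.toNat_le _).antisymm (Nat.one_le_iff_ne_zero.2 hne)
  refine ⟨Verifier.prog, 10, fun x y => ?_, fun x => ?_⟩
  · obtain ⟨m', t, hp, ht, -⟩ := Verifier.runs_prog x y
    refine ⟨_, t, hp _ 0, ht.trans ?_⟩
    calc 10 * x.length + 8 ≤ 10 * (x.length + y.length + 1) ^ 1 := by lia
      _ ≤ 10 * (x.length + y.length + 1) ^ 10 := by gcongr <;> lia
  · simp only [accepts_iff]
    refine ⟨fun ⟨y, hy⟩ => ⟨y, ?_, hy⟩, fun ⟨y, _, hy⟩ => ⟨y, hy⟩⟩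
    calc y.length ≤ 10 * (x.length + 1) ^ 1 := by lia
      _ ≤ 10 * (x.length + 1) ^ 10 := by gcongr <;> lia

/-! ### Deviation as a satisfiability problem -/

namespace GateCode

theorem encode_append (σ τ : List GateCode) : encode (σ ++ τ) = encode σ ++ encode τ := by
  simp [encode, unaryEncode]

theorem length_encode_le {τ : List GateCode} {B : ℕ} (h : ∀ g ∈ τ, g.kind + g.fst + g.snd ≤ B) :
    (encode τ).length ≤ τ.length * (B + 3) := by
  induction τ with
  | nil => simp [encode, unaryEncode]
  | cons g τ ih =>
    rw [List.forall_mem_cons] at h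
    have hτ := ih h.2
    simp only [encode, unaryEncode, toList, List.flatMap_cons, List.flatMap_nil,
      List.flatMap_append, List.length_append, List.length_cons, List.length_nil,
      List.length_replicate, Nat.add_one_mul] at hτ ⊢
    lia

/-- The code of an input gate, which is a free bit if `b` holds and `false` otherwise. -/
def ofInput (b : Bool) : GateCode := ⟨6 - b.toNat, 0, 0⟩

theorem eval_ofInput (w : ℕ → Bool) (c b : Bool) : (ofInput b).eval w c = (b && c) := by
  cases b <;> simp [ofInput, eval]

/-- The code of a gate of a `Circuit`. -/
def ofGate (g : Gate) : GateCode := ⟨g.kind, g.fst, g.snd⟩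

theorem eval_ofGate (w : ℕ → Bool) (c : Bool) (g : Gate) : (ofGate g).eval w c = g.eval w := by
  rcases g with (_ | _) | _ | _ | _ <;>
    simp [ofGate, eval, Gate.eval, Gate.kind, Gate.fst, Gate.snd]

/-- The code of a gate that compares wire `u` with the constant `b`. -/
def ofNe (u : ℕ) (b : Bool) : GateCode := ⟨4 - (b.toNat + b.toNat), u, u⟩

theorem eval_ofNe (w : ℕ → Bool) (c : Bool) (u : ℕ) (b : Bool) :
    (ofNe u b).eval w c = (w u != b) := by
  cases b <;> simp [ofNe, eval]

theorem wires_map_ofInput (y l : List Bool) :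
    wires y (l.map ofInput) = l.mapIdx fun i b => b && y.getD i false := by
  induction l using List.reverseRecOn with
  | nil => rfl
  | append_singleton l b ih =>
    rw [List.map_append, List.map_singleton, wires_append_singleton, eval_ofInput, length_wires,
      List.length_map, ih, List.mapIdx_concat]

end GateCode

section CircuitCode

variable {n : ℕ} (C : Circuit n) (T : Finset (Fin n)) (b : Bool)

/-- The coded circuit that compares the value of `C` with `b`, where the inputs outside `T` are
`false`. -/
def circuitCode : List GateCode :=
  (List.ofFn (indicator T)).map .ofInput ++ C.gates.map .ofGate ++ [.ofNe C.output b]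

theorem length_circuitCode : (circuitCode C T b).length = n + C.size + 1 := by
  simp [circuitCode, Circuit.size, add_assoc]

variable {C T b} in
theorem wires_le_of_mem_circuitCode {g : GateCode} (hg : g ∈ circuitCode C T b) :
    g.kind + g.fst + g.snd ≤ 2 * (n + C.size) + 6 := by
  simp only [circuitCode, List.mem_append, List.mem_map, List.mem_singleton] at hg
  rcases hg with (⟨b, -, rfl⟩ | ⟨g, hg, rfl⟩) | rfl
  · simp only [GateCode.ofInput]; lia
  · obtain ⟨j, hj, rfl⟩ := List.mem_iff_getElem.1 hg
    have hwf := C.wf j hj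
    have hsize : C.size = C.gates.length := rfl
    cases h : C.gates[j] with
    | const b => cases b <;> simp [GateCode.ofGate, Gate.kind, Gate.fst, Gate.snd]
    | _ => simp only [h, Gate.Below, GateCode.ofGate, Gate.kind, Gate.fst, Gate.snd] at hwf ⊢; lia
  · have hsize : C.size = C.gates.length := rfl
    have := C.output_lt
    simp only [GateCode.ofNe]; lia

theorem output_circuitCode (y : List Bool) : GateCode.output y (circuitCode C T b) =
    (C.eval (indicator {i ∈ T | y.getD i false}) != b) := by
  have hinput : GateCode.wires y ((List.ofFn (indicator T)).map .ofInput) =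
      List.ofFn (indicator {i ∈ T | y.getD i false}) := by
    rw [GateCode.wires_map_ofInput]
    refine List.ext_getElem (by simp) fun i _ _ => ?_
    simp [indicator]
  have hwires : GateCode.wires y ((List.ofFn (indicator T)).map .ofInput ++ C.gates.map .ofGate) =
      C.wires (indicator {i ∈ T | y.getD i false}) := by
    rw [GateCode.wires, List.foldl_append, ← GateCode.wires, hinput, List.foldl_map]
    simp only [GateCode.eval_ofGate, Circuit.wires]
  have hlen := congrArg List.length hwires
  rw [GateCode.length_wires] at hlen
  rw [GateCode.output, circuitCode, GateCode.wires_append_singleton, GateCode.eval_ofNe, hwires,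
    List.length_append, hlen, List.length_singleton, Nat.add_sub_cancel]
  simp [Circuit.eval]

theorem encode_circuitCode_mem : GateCode.encode (circuitCode C T b) ∈ circuitSat ↔
    Deviates C.eval b T := by
  simp only [encode_mem_circuitSat, output_circuitCode, bne_iff_ne]
  refine ⟨fun ⟨y, _, hy⟩ => ⟨_, Finset.filter_subset _ _, hy⟩, fun ⟨Y, hY, hne⟩ =>
    ⟨List.ofFn (indicator Y), ?_, ?_⟩⟩
  · grw [← GateCode.length_le_length_encode, length_circuitCode, List.length_ofFn]
    lia
  · convert hne using 3
    ext i
    simpa [indicator] using @hY i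

end CircuitCode

/-! ### Asking the oracle whether the function deviates -/

namespace Certifier

abbrev fixed : ℕ := 0
abbrev gateKind : ℕ := 1
abbrev gateFst : ℕ := 2
abbrev gateSnd : ℕ := 3
abbrev numInputs : ℕ := 4
abbrev numGates : ℕ := 5
abbrev outputWire : ℕ := 6
abbrev baseValue : ℕ := 7
abbrev free : ℕ := 8
abbrev varIdx : ℕ := 9
abbrev answer : ℕ := 10
abbrev queryBits : ℕ := 11
abbrev queryLen : ℕ := 12
abbrev gateIdx : ℕ := 13
abbrev counter : ℕ := 14
abbrev limit : ℕ := 15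

/-- The arrays that a query changes. -/
abbrev scratch : Set ℕ := {answer, queryBits, queryLen, gateIdx, counter, limit}

/-- The arrays that change during the search. -/
abbrev volatile : Set ℕ := {fixed, free, varIdx} ∪ scratch

open Certification.Expr (var)

/-- The query written so far. -/
def queryString (m : Memory) : List Bool := m.bits queryBits (m queryLen 0)

theorem queryString_write (m : Memory) {a : ℕ} (i k : ℕ) (h : a ∉ ({queryBits, queryLen} : Set ℕ)) :
    queryString (m.write a i k) = queryString m := by
  rw [Set.mem_insert_iff, Set.mem_singleton_iff, not_or] at h
  simp [queryString, Memory.bits, Ne.symm h.1, Ne.symm h.2]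

theorem queryString_eq (m : Memory) :
    queryString m = (m.list queryBits queryLen).map (decide <| · ≠ 0) :=
  Memory.bits_eq_map_list _ _ _

/-- Appends the unary code of the value of `e` to the query. -/
def pushUnary (e : Expr) : Prog :=
  .seq (.set limit e) <|
  .seq (.forLoop counter limit (.push queryBits queryLen (.const 1))) <|
  .push queryBits queryLen (.const 0)

def pushGate (e₁ e₂ e₃ : Expr) : Prog :=
  .seq (pushUnary e₁) <| .seq (pushUnary e₂) <| pushUnary e₃

/-- Appends one gate for each value of the variable `gateIdx` below that of `bound`. -/
def pushGates (bound : ℕ) (e₁ e₂ e₃ : Expr) : Prog := .forLoop gateIdx bound (pushGate e₁ e₂ e₃)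

variable {L : Set (List Bool)} {m : Memory} {e e₁ e₂ e₃ : Expr}

theorem runs_pushBit (b : Bool) :
    Runs L (.push queryBits queryLen (.const b.toNat)) m 2 fun m' =>
      Set.EqOn m' m {queryBits, queryLen}ᶜ ∧ queryString m' = queryString m ++ [b] := by
  refine (Runs.push (by simp)).mono le_rfl fun m' h => ⟨h.1, ?_⟩
  rw [queryString_eq, h.2, queryString_eq]
  cases b <;> simp [Expr.eval]

theorem runs_pushUnary {k : ℕ} (hk : e.eval m = k) :
    Runs L (pushUnary e) m (4 * k + 5) fun m' =>
      Set.EqOn m' m {queryBits, queryLen, counter, limit}ᶜ ∧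
        queryString m' = queryString m ++ unaryEncode [k] := by
  have hones : Runs L (.forLoop counter limit (.push queryBits queryLen (.const 1)))
      (m.write limit 0 k) (k * (2 + 2) + 2) fun m' =>
        Set.EqOn m' m {queryBits, queryLen, counter, limit}ᶜ ∧ m' limit 0 = k ∧
          queryString m' = queryString m ++ List.replicate k true := by
    refine Runs.forLoop (fun j m' => Set.EqOn m' m {queryBits, queryLen, counter, limit}ᶜ ∧
      m' limit 0 = k ∧ queryString m' = queryString m ++ List.replicate j true) ?_ k
      (fun _ _ h => h.2.1) ?_
    · refine ⟨Memory.eqOn_write _ _ (Memory.eqOn_write _ _ (Set.eqOn_refl _ _) ?_) ?_, ?_, ?_⟩ <;>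
        simp [queryString_write]
    · rintro j m' - ⟨hf, hlimit, hs⟩ hj
      refine (runs_pushBit true).mono le_rfl fun m'' ⟨hf', hs'⟩ => ⟨?_, ?_, ?_, ?_⟩
      · rw [hf' (by simp), hj]
      · exact Memory.eqOn_write _ _ (Memory.eqOn_trans hf' hf (by simp [Set.insert_subset_iff]))
          (by simp)
      · rw [Memory.write_of_ne _ _ _ _ (by simp), hf' (by simp), hlimit]
      · rw [queryString_write _ _ _ (by simp), hs', hs, List.replicate_succ', List.append_assoc]
  refine (Runs.assign_seq <| Runs.seq (hk ▸ hones) fun m₁ ⟨hf, _, hs⟩ =>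
    (runs_pushBit false).mono le_rfl fun m₂ ⟨hf', hs'⟩ => ⟨?_, ?_⟩).mono (by lia) fun _ h => h
  · exact Memory.eqOn_trans hf' hf (by simp [Set.insert_subset_iff])
  · rw [hs', hs]
    simp [unaryEncode, hk]

theorem runs_pushGate {g : GateCode}
    (h : ∀ m', Set.EqOn m' m {queryBits, queryLen, counter, limit}ᶜ →
      e₁.eval m' = g.kind ∧ e₂.eval m' = g.fst ∧ e₃.eval m' = g.snd) :
    Runs L (pushGate e₁ e₂ e₃) m (4 * (g.kind + g.fst + g.snd) + 15) fun m' =>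
      Set.EqOn m' m {queryBits, queryLen, counter, limit}ᶜ ∧
        queryString m' = queryString m ++ GateCode.encode [g] := by
  refine ((runs_pushUnary (h m (Set.eqOn_refl _ _)).1).seq fun m₁ ⟨hf₁, hs₁⟩ =>
    (runs_pushUnary (h m₁ hf₁).2.1).seq fun m₂ ⟨hf₂, hs₂⟩ =>
    (runs_pushUnary (h m₂ (hf₂.trans hf₁)).2.2).mono le_rfl fun m₃ ⟨hf₃, hs₃⟩ =>
    ⟨hf₃.trans (hf₂.trans hf₁), ?_⟩).mono (by lia) fun _ h => h
  simp [hs₃, hs₂, hs₁, GateCode.encode, GateCode.toList, unaryEncode]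

theorem runs_pushGates {bound B : ℕ} {τ : List GateCode} (hbound : bound ∉ scratch)
    (hlen : m bound 0 = τ.length) (hB : ∀ g ∈ τ, g.kind + g.fst + g.snd ≤ B)
    (h : ∀ k (hk : k < τ.length) m', Set.EqOn m' m scratchᶜ → m' gateIdx 0 = k →
      e₁.eval m' = τ[k].kind ∧ e₂.eval m' = τ[k].fst ∧ e₃.eval m' = τ[k].snd) :
    Runs L (pushGates bound e₁ e₂ e₃) m (τ.length * (4 * B + 17) + 2) fun m' =>
      Set.EqOn m' m scratchᶜ ∧ queryString m' = queryString m ++ GateCode.encode τ := by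
  refine (Runs.forLoop (B := 4 * B + 15) (fun k m' => Set.EqOn m' m scratchᶜ ∧
    queryString m' = queryString m ++ GateCode.encode (τ.take k)) ?_ τ.length ?_ ?_).mono le_rfl ?_
  · exact ⟨Memory.eqOn_write _ _ (Set.eqOn_refl _ _) (by simp), by
      simp [queryString_write, GateCode.encode, unaryEncode]⟩
  · rintro k m' ⟨hf, -⟩
    rw [hf hbound, hlen]
  · rintro k m' hk ⟨hf, hs⟩ hidx
    refine (runs_pushGate (g := τ[k]) fun m'' hf' => h k hk m'' ?_ ?_).mono
      (by grind [hB _ (List.getElem_mem hk)]) fun m'' ⟨hf', hs'⟩ => ⟨?_, ?_, ?_⟩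
    · exact Memory.eqOn_trans hf' hf (by simp [Set.insert_subset_iff])
    · rw [hf' (by simp), hidx]
    · rw [hf' (by simp), hidx]
    · exact Memory.eqOn_write _ _ (Memory.eqOn_trans hf' hf (by simp [Set.insert_subset_iff]))
        (by simp)
    · rw [List.take_add_one, List.getElem?_eq_getElem hk, Option.toList, GateCode.encode_append,
        ← List.append_assoc, ← hs, ← hs', queryString_write _ _ _ (by simp)]
  · rintro m' ⟨hf, hs⟩
    exact ⟨hf, by rwa [List.take_length] at hs⟩

/-- The memory holds the circuit `C`, the value `b` that the queries refer to, the set `S` of fixed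
variables and the set `T` of variables that a query may set to `true`. -/
structure Holds {n : ℕ} (C : Circuit n) (b : Bool) (S T : Finset (Fin n)) (m : Memory) : Prop where
  gateKind : m gateKind = inputMemory C 0 gateKind
  gateFst : m gateFst = inputMemory C 0 gateFst
  gateSnd : m gateSnd = inputMemory C 0 gateSnd
  numInputs : m numInputs 0 = n
  numGates : m numGates 0 = C.size
  outputWire : m outputWire 0 = C.output
  baseValue : m baseValue 0 = b.toNat
  holdsSet_fixed : m.HoldsSet fixed S
  holdsSet_free : m.HoldsSet free T

section

variable {n : ℕ} {C : Circuit n} {b : Bool} {S S' T T' : Finset (Fin n)} {m m' : Memory}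

theorem Holds.of_eqOn (h : Holds C b S T m) (hm : Set.EqOn m' m volatileᶜ)
    (hS : m'.HoldsSet fixed S') (hT : m'.HoldsSet free T') : Holds C b S' T' m' where
  gateKind := (hm (by simp)).trans h.gateKind
  gateFst := (hm (by simp)).trans h.gateFst
  gateSnd := (hm (by simp)).trans h.gateSnd
  numInputs := (congrFun (hm (by simp)) 0).trans h.numInputs
  numGates := (congrFun (hm (by simp)) 0).trans h.numGates
  outputWire := (congrFun (hm (by simp)) 0).trans h.outputWire
  baseValue := (congrFun (hm (by simp)) 0).trans h.baseValue
  holdsSet_fixed := hS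
  holdsSet_free := hT

theorem Holds.congr (h : Holds C b S T m) (hm : Set.EqOn m' m scratchᶜ) : Holds C b S T m' :=
  h.of_eqOn (hm.mono (Set.compl_subset_compl.2 Set.subset_union_right))
    (h.holdsSet_fixed.congr (hm (by simp))) (h.holdsSet_free.congr (hm (by simp)))

theorem Holds.write_varIdx (h : Holds C b S T m) (k : ℕ) :
    Holds C b S T (m.write varIdx 0 k) :=
  h.of_eqOn (Memory.eqOn_write _ _ (Set.eqOn_refl _ _) (by simp))
    (h.holdsSet_fixed.congr (by simp)) (h.holdsSet_free.congr (by simp))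

theorem Holds.write_free {i k : ℕ} (h : Holds C b S T m)
    (hT : (m.write free i k).HoldsSet free T') :
    Holds C b S T' (m.write free i k) :=
  h.of_eqOn (Memory.eqOn_write _ _ (Set.eqOn_refl _ _) (by simp))
    (h.holdsSet_fixed.congr (by simp)) hT

/-- Writes the code of `circuitCode C T b` as the query. The kinds of the gates other than those of
`C` are computed as in `GateCode.ofInput` and `GateCode.ofNe`. -/
def writeQuery : Prog :=
  .seq (.set queryLen (.const 0)) <|
  .seq (pushGates numInputs (.sub (.const 6) (.read free (var gateIdx))) (.const 0) (.const 0)) <|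
  .seq (pushGates numGates (.read gateKind (var gateIdx)) (.read gateFst (var gateIdx))
    (.read gateSnd (var gateIdx))) <|
  pushGate (.sub (.const 4) (.add (var baseValue) (var baseValue))) (var outputWire)
    (var outputWire)

/-- Asks whether the function deviates from the base value on the free variables. -/
def queryProg : Prog := .seq writeQuery (.query queryBits (var queryLen) answer)

variable {L : Set (List Bool)}

theorem runs_pushInputs (h : Holds C b S T m) :
    Runs L (pushGates numInputs (.sub (.const 6) (.read free (var gateIdx))) (.const 0) (.const 0))
      m (n * (4 * (2 * (n + C.size) + 6) + 17) + 2) fun m' =>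
        Set.EqOn m' m scratchᶜ ∧ queryString m' =
          queryString m ++ GateCode.encode ((List.ofFn (indicator T)).map .ofInput) := by
  refine (runs_pushGates (B := 2 * (n + C.size) + 6) (by simp) (by simpa using h.numInputs)
    (fun g hg => wires_le_of_mem_circuitCode (C := C) (T := T) (b := b) ?_) ?_).mono
    (by simp) fun _ h => h
  · simp only [circuitCode, List.mem_append, hg, true_or]
  · intro k hk m' hm hidx
    have hk : k < n := by simpa using hk
    have hfree : m' free k = (indicator T ⟨k, hk⟩).toNat := (h.congr hm).holdsSet_free ⟨k, hk⟩
    simp [Expr.eval, hidx, hfree, GateCode.ofInput]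

theorem runs_pushGatesOfCircuit (h : Holds C b S T m) :
    Runs L (pushGates numGates (.read gateKind (var gateIdx)) (.read gateFst (var gateIdx))
      (.read gateSnd (var gateIdx))) m (C.size * (4 * (2 * (n + C.size) + 6) + 17) + 2) fun m' =>
        Set.EqOn m' m scratchᶜ ∧
          queryString m' = queryString m ++ GateCode.encode (C.gates.map .ofGate) := by
  refine (runs_pushGates (B := 2 * (n + C.size) + 6) (by simp)
    (by simpa [Circuit.size] using h.numGates)
    (fun g hg => wires_le_of_mem_circuitCode (C := C) (T := T) (b := b) ?_) ?_).mono
    (by simp [Circuit.size]) fun _ h => h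
  · simp only [circuitCode, List.mem_append, hg, or_true, true_or]
  · intro k hk m' hm hidx
    have hk : k < C.gates.length := by simpa using hk
    obtain ⟨hkind, hfst, hsnd, _⟩ := h.congr hm
    simp [Expr.eval, hidx, hkind, hfst, hsnd, inputMemory, hk, GateCode.ofGate]

theorem runs_writeQuery (h : Holds C b S T m) :
    Runs L writeQuery m (44 * (n + C.size + 1) ^ 2) fun m' =>
      Set.EqOn m' m scratchᶜ ∧ queryString m' = GateCode.encode (circuitCode C T b) := by
  have hclear := Memory.eqOn_write 0 0 (Set.eqOn_refl m scratchᶜ) (a := queryLen) (by simp)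
  refine (Runs.assign_seq <| (runs_pushInputs (h.congr hclear)).seq fun m₁ ⟨hf₁, hs₁⟩ =>
    (runs_pushGatesOfCircuit (h.congr (hf₁.trans hclear))).seq fun m₂ ⟨hf₂, hs₂⟩ => ?_).mono
    (T := 1 + (n * (4 * (2 * (n + C.size) + 6) + 17) + 2 +
      (C.size * (4 * (2 * (n + C.size) + 6) + 17) + 2 + (4 * (2 * (n + C.size) + 6) + 15))))
    (by nlinarith) fun _ h => h
  have hf : Set.EqOn m₂ m scratchᶜ := hf₂.trans (hf₁.trans hclear)
  refine (runs_pushGate (g := .ofNe C.output b) fun m' hf' => ?_).mono ?_ fun m₃ ⟨hf₃, hs₃⟩ =>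
    ⟨Memory.eqOn_trans hf₃ hf (by simp [Set.insert_subset_iff]), ?_⟩
  · have hm' := h.congr (Memory.eqOn_trans hf' hf (by simp [Set.insert_subset_iff]))
    simp [Expr.eval, hm'.baseValue, hm'.outputWire, GateCode.ofNe]
  · grw [wires_le_of_mem_circuitCode (C := C) (T := T) (b := b)
      (List.mem_append_right _ (List.mem_singleton_self _))]
  · have hempty : queryString (m.write queryLen 0 0) = [] := by simp [queryString, Memory.bits]
    rw [hs₃, hs₂, hs₁, hempty, List.nil_append, circuitCode, GateCode.encode_append,
      GateCode.encode_append]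

theorem runs_queryProg (h : Holds C b S T m) :
    Runs circuitSat queryProg m (54 * (n + C.size + 1) ^ 2) fun m' =>
      Holds C b S T m' ∧ Set.EqOn m' m scratchᶜ ∧
        m' answer 0 = (decide (Deviates C.eval b T)).toNat := by
  refine ((runs_writeQuery h).seq (T' := (n + C.size + 1) * (2 * (n + C.size) + 6 + 3) + 1)
    fun m₁ ⟨hf, hs⟩ => ?_).mono (by nlinarith) fun _ h => h
  have hlen : m₁ queryLen 0 = (GateCode.encode (circuitCode C T b)).length := by
    simp [← hs, queryString, Memory.bits]
  have hwrite (k : ℕ) : Set.EqOn (m₁.write answer 0 k) m scratchᶜ :=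
    Memory.eqOn_write _ _ hf (by simp)
  change m₁.bits queryBits ((var queryLen).eval m₁) = _ at hs
  refine (Runs.query ⟨h.congr (hwrite _), hwrite _, ?_⟩).mono ?_ fun _ h => h
  · change m₁ queryLen 0 + 1 ≤ _
    grw [hlen, GateCode.length_encode_le fun g hg => wires_le_of_mem_circuitCode hg,
      length_circuitCode]
  · simp [hs, encode_circuitCode_mem, Bool.toNat, cond_eq_ite]

end

/-! ### The search for blocks -/

/-- Fixes all variables that are allowed to be `true`. -/
def fixProg : Prog :=
  .fill varIdx numInputs fixed (.sup (.read fixed (var varIdx)) (.read free (var varIdx)))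

/-- Allows exactly the variables that are not fixed to be `true`. -/
def freeOthersProg : Prog := .fill varIdx numInputs free (.compl (.read fixed (var varIdx)))

/-- Adds the block just found to the fixed variables and asks whether there is another one. -/
def extendProg : Prog := .seq fixProg <| .seq freeOthersProg queryProg

def shrinkStep : Prog :=
  .seq (.assign free (var varIdx) (.const 0)) <| .seq queryProg <|
  .assign free (var varIdx) (.compl (var answer))

/-- Shrinks the set of free variables greedily to a minimal block. -/
def shrinkProg : Prog := .forLoop varIdx numInputs shrinkStep

def initProg : Prog :=
  .seq (.set numInputs (.read 0 (.const 0))) <| .seq (.set numGates (.read 0 (.const 1))) <|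
  .seq (.set outputWire (.read 0 (.const 2))) <| .fill varIdx numInputs fixed (.const 0)

/-- The algorithm of the theorem. Its first query is about the empty set of variables and the value
`false`, so the answer is the value of the circuit at zero. -/
def prog : Prog :=
  .seq initProg <| .seq queryProg <| .seq (.set baseValue (var answer)) <| .seq extendProg <|
  .loop (var answer) (.seq shrinkProg extendProg)

variable {n : ℕ} {C : Circuit n} {L : Set (List Bool)} {b : Bool}
  {S T : Finset (Fin n)} {m : Memory}

theorem runs_fixProg (h : Holds C b S T m) :
    Runs L fixProg m (n * 3 + 2) (Holds C b (S ∪ T) T) := by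
  refine (Runs.fill (S := S ∪ T) (by simp) (by simp) h.numInputs ?_).mono le_rfl
    fun m' ⟨hf, hfixed⟩ => h.of_eqOn (hf.mono (by simp [Set.insert_subset_iff])) hfixed
      (h.holdsSet_free.congr (hf (by simp)))
  intro k m' hf hk hi
  have hfixed : (Expr.read fixed (var varIdx)).eval m' = (decide (k ∈ S)).toNat := by
    simp [Expr.eval, hi, hk, h.holdsSet_fixed k]
  have hfree : (Expr.read free (var varIdx)).eval m' = (decide (k ∈ T)).toNat := by
    simp [Expr.eval, hi, hf (x := free) (by simp), h.holdsSet_free k]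
  simp [Expr.eval_sup hfixed hfree, Bool.decide_or]

theorem runs_freeOthersProg (h : Holds C b S T m) :
    Runs L freeOthersProg m (n * 3 + 2) (Holds C b S Sᶜ) := by
  refine (Runs.fill (S := Sᶜ) (by simp) (by simp) h.numInputs ?_).mono le_rfl
    fun m' ⟨hf, hfree⟩ => h.of_eqOn (hf.mono (by simp [Set.insert_subset_iff]))
      (h.holdsSet_fixed.congr (hf (by simp))) hfree
  intro k m' hf _ hi
  have hfixed : (Expr.read fixed (var varIdx)).eval m' = (decide (k ∈ S)).toNat := by
    simp [Expr.eval, hi, hf (x := fixed) (by simp), h.holdsSet_fixed k]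
  simp [Expr.eval_compl hfixed]

theorem runs_extendProg (h : Holds C b S T m) :
    Runs circuitSat extendProg m (54 * (n + C.size + 1) ^ 2 + 6 * n + 4) fun m' =>
      Holds C b (S ∪ T) (S ∪ T)ᶜ m' ∧
        m' answer 0 = (decide (Deviates C.eval b (S ∪ T)ᶜ)).toNat :=
  ((runs_fixProg h).seq fun _ h₁ => (runs_freeOthersProg h₁).seq fun _ h₂ =>
    (runs_queryProg h₂).mono le_rfl fun _ h₃ => ⟨h₃.1, h₃.2.2⟩).mono (by lia) fun _ h => h

theorem runs_shrinkStep {i : Fin n} (h : Holds C (C.eval (indicator ∅)) S T m)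
    (hi : m varIdx 0 = i) (hT : IsIrredundantBelow C.eval i T) :
    Runs circuitSat shrinkStep m (54 * (n + C.size + 1) ^ 2 + 2) fun m' =>
      m' varIdx 0 = i ∧ ∃ T' ⊆ T, Holds C (C.eval (indicator ∅)) S T' m' ∧
        IsIrredundantBelow C.eval (i + 1) T' := by
  refine (Runs.assign_seq <| Runs.seq (hi ▸ runs_queryProg (h.write_free
    (h.holdsSet_free.erase i))) (T' := 1) fun m' ⟨hm', hf, ha⟩ => Runs.assign ?_).mono
    (by lia) fun _ h => h
  have hi' : m' varIdx 0 = i := by simp [hf (x := varIdx) (by simp), hi]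
  have hanswer : (var answer).compl.eval m' = _ := Expr.eval_compl ha
  rw [hanswer, show (var varIdx).eval m' = i from hi']
  refine ⟨by simp [hi'], ?_⟩
  by_cases hd : Deviates C.eval (C.eval (indicator ∅)) (T.erase i)
  · refine ⟨T.erase i, T.erase_subset i, hm'.write_free ?_, hT.erase hd⟩
    simpa [hd] using hm'.holdsSet_free.erase i
  · have hiT : i ∈ T := by
      by_contra hiT
      rw [Finset.erase_eq_of_notMem hiT] at hd
      exact hd hT.deviates
    refine ⟨T, subset_rfl, hm'.write_free ?_, hT.keep hd⟩
    simpa [hd, Finset.insert_erase hiT] using hm'.holdsSet_free.insert i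

theorem runs_shrinkProg (h : Holds C (C.eval (indicator ∅)) S T m)
    (hT : Deviates C.eval (C.eval (indicator ∅)) T) :
    Runs circuitSat shrinkProg m (n * (54 * (n + C.size + 1) ^ 2 + 4) + 2) fun m' =>
      ∃ T' ⊆ T, Holds C (C.eval (indicator ∅)) S T' m' ∧ IsMinBlock C.eval T' := by
  refine (Runs.forLoop (B := 54 * (n + C.size + 1) ^ 2 + 2) (fun k m' => ∃ T' ⊆ T,
    Holds C (C.eval (indicator ∅)) S T' m' ∧ IsIrredundantBelow C.eval k T')
    ⟨T, subset_rfl, h.write_varIdx _, .zero hT⟩ n ?_ ?_).mono le_rfl ?_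
  · rintro k m' ⟨T', -, hm', -⟩
    exact hm'.numInputs
  · rintro k m' hk ⟨T', hsub, hm', hirr⟩ hk'
    exact (runs_shrinkStep (i := ⟨k, hk⟩) hm' hk' hirr).mono le_rfl
      fun _ ⟨hk'', T'', hsub', hm'', hirr'⟩ =>
        ⟨hk'', T'', hsub'.trans hsub, hm''.write_varIdx _, hirr'⟩
  · rintro m' ⟨T', hsub, hm', hirr⟩
    exact ⟨T', hsub, hm', hirr.isMinBlock⟩

theorem runs_initProg (C : Circuit n) (r : ℕ) :
    Runs L initProg (inputMemory C r) (3 * n + 5) (Holds C false ∅ ∅) := by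
  let m := (((inputMemory C r).write numInputs 0 n).write numGates 0 C.size).write outputWire 0
    C.output
  have hm (a : ℕ) (ha : a ∉ ({numInputs, numGates, outputWire} : Set ℕ)) :
      m a = inputMemory C r a := by
    simp only [Set.mem_insert_iff, Set.mem_singleton_iff, not_or] at ha
    simp [m, ha]
  refine (Runs.assign_seq <| Runs.assign_seq <| Runs.assign_seq <| Runs.mono (m := m)
    (Runs.fill (n := n) (S := ∅) (by simp) (by simp) (by simp [m]) (by simp [Expr.eval]))
    le_rfl ?_).mono (by lia) fun _ h => h
  rintro m' ⟨hf, hfixed⟩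
  exact {
    gateKind := (hf (by simp)).trans (hm _ (by simp))
    gateFst := (hf (by simp)).trans (hm _ (by simp))
    gateSnd := (hf (by simp)).trans (hm _ (by simp))
    numInputs := by simp [hf (x := numInputs) (by simp), m]
    numGates := by simp [hf (x := numGates) (by simp), m]
    outputWire := by simp [hf (x := outputWire) (by simp), m]
    baseValue := congrFun ((hf (by simp)).trans (hm _ (by simp))) 0
    holdsSet_fixed := hfixed
    holdsSet_free := fun i => congrFun ((hf (by simp)).trans (hm _ (by simp))) i }

/-- The invariant of the main loop, in which the set `S` of fixed variables is a union of blocks. -/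
def Invariant (C : Circuit n) (S : Finset (Fin n)) (m : Memory) : Prop :=
  IsBlockUnion C.eval S ∧ Holds C (C.eval (indicator ∅)) S Sᶜ m ∧
    m answer 0 = (decide (Deviates C.eval (C.eval (indicator ∅)) Sᶜ)).toNat

theorem loopBody_time {N : ℕ} (h : n + 1 ≤ N) :
    n * (54 * N ^ 2 + 4) + 2 + (54 * N ^ 2 + 6 * n + 4) ≤ 64 * N ^ 3 :=
  calc n * (54 * N ^ 2 + 4) + 2 + (54 * N ^ 2 + 6 * n + 4)
      ≤ (n + 1) * (54 * N ^ 2 + 10) := by lia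
    _ ≤ N * (54 * N ^ 2 + 10 * N ^ 2) := by gcongr; nlinarith
    _ = 64 * N ^ 3 := by ring

theorem prog_time {N : ℕ} (h : n + 1 ≤ N) :
    3 * n + 5 + (54 * N ^ 2 + (1 + (54 * N ^ 2 + 6 * n + 4 + (n * (64 * N ^ 3 + 1) + 1)))) ≤
      200 * N ^ 4 := by
  have hN : 1 ≤ N := by lia
  have hn : n * (64 * N ^ 3 + 1) ≤ N * (64 * N ^ 3 + N ^ 3) := by
    gcongr
    · lia
    · exact Nat.one_le_pow _ _ hN
  have h₁ : N ≤ N ^ 4 := Nat.le_self_pow (by simp) N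
  have h₂ : N ^ 2 ≤ N ^ 4 := Nat.pow_le_pow_right hN (by simp)
  lia

theorem runs_loopBody (h : Invariant C S m) (hne : m answer 0 ≠ 0) :
    Runs circuitSat (.seq shrinkProg extendProg) m (64 * (n + C.size + 1) ^ 3) fun m' =>
      ∃ S', S'ᶜ.card < Sᶜ.card ∧ Invariant C S' m' := by
  obtain ⟨hS, hm, ha⟩ := h
  have hdev : Deviates C.eval (C.eval (indicator ∅)) Sᶜ := by simpa [ha] using hne
  refine ((runs_shrinkProg hm hdev).seq fun m₁ ⟨T, hT, hm₁, hblock⟩ =>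
    (runs_extendProg hm₁).mono le_rfl fun m₂ hm₂ => ⟨S ∪ T, Finset.card_lt_card ?_,
      hS.union ?_ hblock, hm₂⟩).mono (loopBody_time (by lia)) fun _ h => h
  · rw [compl_lt_compl_iff_lt, ← Finset.sup_eq_union, left_lt_sup]
    exact fun hTS => hblock.ne_empty (disjoint_self.1 (disjoint_compl_right.mono hTS hT))
  · exact disjoint_compl_right.mono_right hT

theorem runs_loop (h : Invariant C S m) :
    Runs circuitSat (.loop (var answer) (.seq shrinkProg extendProg)) m
      (n * (64 * (n + C.size + 1) ^ 3 + 1) + 1) fun m' =>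
        ∃ S', Invariant C S' m' ∧ m' answer 0 = 0 := by
  refine (Runs.loop (e := var answer) (Invariant C) (fun S => Sᶜ.card)
    (fun _ _ hm hne => runs_loopBody hm hne) S h).mono ?_ fun m' ⟨⟨S', hS'⟩, h0⟩ => ⟨S', hS', h0⟩
  gcongr
  simpa using Sᶜ.card_le_univ

theorem Invariant.output (h : Invariant C S m) (h0 : m answer 0 = 0) :
    (outputRestriction n m).length ≤ cert C.eval ^ 2 ∧
      IsConstant (restrict C.eval (outputRestriction n m)) := by
  obtain ⟨hS, hm, ha⟩ := h
  rw [outputRestriction_eq_zeroOn hm.holdsSet_fixed, length_zeroOn]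
  exact ⟨hS.card_le, isConstant_restrict_zeroOn (by simpa [ha] using h0)⟩

theorem runs_prog (C : Circuit n) (r : ℕ) :
    Runs circuitSat prog (inputMemory C r) (200 * (n + C.size + 1) ^ 4) fun m' =>
      (outputRestriction n m').length ≤ cert C.eval ^ 2 ∧
        IsConstant (restrict C.eval (outputRestriction n m')) := by
  have hbase {m : Memory} (h : Holds C false ∅ ∅ m)
      (ha : m answer 0 = (decide (Deviates C.eval false ∅)).toNat) :
      Holds C (C.eval (indicator ∅)) ∅ ∅ (m.write baseValue 0 (m answer 0)) := by
    refine { h with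
      baseValue := ?_
      holdsSet_fixed := h.holdsSet_fixed.congr (by simp)
      holdsSet_free := h.holdsSet_free.congr (by simp) }
    simp [ha, deviates_empty]
  refine ((runs_initProg C r).seq fun m₁ hm₁ => (runs_queryProg hm₁).seq fun m₂ ⟨hm₂, _, ha₂⟩ =>
    Runs.assign_seq <| (runs_extendProg (hbase hm₂ ha₂)).seq fun m₃ hm₃ =>
    (runs_loop (S := ∅) ⟨.empty, by simpa using hm₃⟩).mono le_rfl
      fun m₄ ⟨S, hS, h0⟩ => hS.output h0).mono (prog_time (by lia)) fun _ h => h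

end Certifier

instance : MeasureTheory.IsProbabilityMeasure coinMeasure := by
  unfold coinMeasure
  infer_instance

theorem cast_le_mul_pow_of_le {c N t : ℕ} {x : ℝ} (ht : t ≤ c * (N + 1) ^ 4) (hx : 0 ≤ x) :
    (t : ℝ) ≤ (c + 4 : ℕ) * (N + x + 1) ^ (c + 4) :=
  calc (t : ℝ) ≤ c * (N + 1) ^ 4 := mod_cast ht
    _ ≤ (c + 4 : ℕ) * (N + x + 1) ^ 4 := by
      gcongr
      · lia
      · linarith
    _ ≤ (c + 4 : ℕ) * (N + x + 1) ^ (c + 4) := by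
      gcongr
      · exact le_add_of_nonneg_left (by positivity)
      · lia

end Certification

theorem lemma5p1_general :
    ∃ L : Set (List Bool), InNP L ∧
    ∃ (A : Prog) (c : ℕ),
      ∀ (n : ℕ) (C : Circuit n) (r : ℕ),
        Runs L A (inputMemory C r) (c * (n + C.size + 1) ^ 4) fun m =>
          (outputRestriction n m).length ≤ cert C.eval ^ 2 ∧
            IsConstant (restrict C.eval (outputRestriction n m)) :=
  ⟨circuitSat, circuitSat_inNP, Certifier.prog, 200, fun _ => Certifier.runs_prog⟩

theorem lemma5p1 :
    ∃ L : Set (List Bool), InNP L ∧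
    ∃ (A : Prog) (c K : ℕ),
      ∀ (n : ℕ) (C : Circuit n) (δ : ℝ), 0 < δ → δ < 1 →
        (∀ ω : ℕ → Bool, ∃ (s : State) (t : ℕ),
          Exec L ω A ⟨inputMemory C ⌈Real.logb 2 (1 / δ)⌉₊, 0⟩ s t ∧
          (t : ℝ) ≤ c * (n + C.size + Real.log (1 / δ) + 1) ^ c) ∧
        1 - δ ≤ coinMeasure.real {ω : ℕ → Bool | ∃ (s : State) (t : ℕ),
          Exec L ω A ⟨inputMemory C ⌈Real.logb 2 (1 / δ)⌉₊, 0⟩ s t ∧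
          (outputRestriction n s.mem).length ≤ K * cert C.eval ^ 4 ∧
          IsConstant (restrict C.eval (outputRestriction n s.mem))} := by
  obtain ⟨L, hL, A, c, hA⟩ := lemma5p1_general
  refine ⟨L, hL, A, c + 4, 1, fun n C δ hδ hδ' => ?_⟩
  obtain ⟨m, t, hexec, ht, hlen, hconst⟩ := hA n C ⌈Real.logb 2 (1 / δ)⌉₊
  have hlog : 0 ≤ Real.log (1 / δ) := Real.log_nonneg ((one_le_div hδ).2 hδ'.le)
  have hcert : cert C.eval ^ 2 ≤ 1 * cert C.eval ^ 4 := by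
    rw [one_mul, pow_mul _ 2 2]
    exact Nat.le_self_pow two_ne_zero _
  refine ⟨fun ω => ⟨_, t, hexec ω 0, mod_cast cast_le_mul_pow_of_le ht hlog⟩, ?_⟩
  calc 1 - δ ≤ coinMeasure.real Set.univ := by simpa using hδ.le
    _ ≤ _ := MeasureTheory.measureReal_mono fun ω _ => by
      exact ⟨_, t, hexec ω 0, hlen.trans hcert, hconst⟩
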